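/- A *tt-category* is an essentially small, idempotent-complete triangulated category $\mathcal K$ with a symmetric monoidal structure $\otimes$ (unit $\mathbb 1$) such that $x\otimes-$ is exact for every object $x$; the isomorphisms $x\otimes\Sigma y\cong\Sigma(x\otimes y)$ involved are natural in $x$ and $y$ and compatible with the associativity and unit isomorphisms of $\otimes$. A *thick $\otimes$-ideal* is a full triangulated subcategory closed under direct summands and under tensoring with arbitrary objects. The *spectrum* $\operatorname{Spc}(\mathcal K)$ is the set of *primes*, i.e. of proper thick $\otimes$-ideals $\mathcal P$ such that $x\otimes y\in\mathcal P$ implies $x\in\mathcal P$ or $y\in\mathcal P$, with the topology whose basic open sets are $\{\mathcal P\mid x\in\mathcal P\}$, $x\in\mathcal K$. A *tt-ring* $A$ in $\mathcal K$ is a commutative ring object $(A,\mu,\eta)$ that is separable: there is $\sigma:A\to A\otimes A$ with $\mu\sigma=\mathrm{id}_A$ and $(1\otimes\mu)(\sigma\otimes1)=\sigma\mu=(\mu\otimes1)(1\otimes\sigma)$. Let $A\text{-}\mathrm{Mod}_{\mathcal K}$ be the category of $A$-modules in $\mathcal K$, with the triangles whose underlying triangle in $\mathcal K$ is distinguished as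 its distinguished triangles, and with the tensor product $\otimes_A$ (the coequalizer of the two maps $x\otimes A\otimes y\rightrightarrows x\otimes y$); its spectrum is defined as above. Let $F_A:\mathcal K\to A\text{-}\mathrm{Mod}_{\mathcal K}$, $y\mapsto(A\otimes y,\mu\otimes1)$, be extension of scalars, and $\varphi_A:\operatorname{Spc}(A\text{-}\mathrm{Mod}_{\mathcal K})\to\operatorname{Spc}(\mathcal K)$, $\mathcal Q\mapsto F_A^{-1}(\mathcal Q)$, the induced map. **Theorem (Going-Up).** Let $A$ be a tt-ring in a tt-category $\mathcal K$, let $\mathcal Q\in\operatorname{Spc}(A\text{-}\mathrm{Mod}_{\mathcal K})$ and $\mathcal P'\in\operatorname{Spc}(\mathcal K)$. If $\mathcal P'\in\overline{\{\varphi_A(\mathcal Q)\}}$, then there is $\mathcal Q'\in\overline{\{\mathcal Q\}}$ with $\varphi_A(\mathcal Q')=\mathcal P'$. In other words: if $\mathcal P'\subseteq F_A^{-1}(\mathcal Q)$, then there is $\mathcal Q'\in\operatorname{Spc}(A\text{-}\mathrm{Mod}_{\mathcal K})$ with $\mathcal Q'\subseteq\mathcal Q$ and $F_A^{-1}(\mathcal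 Q')=\mathcal P'$. -/

import Mathlib

open CategoryTheory MonoidalCategory Limits Pretriangulated
open scoped MonObj

universe v u

set_option linter.unusedSectionVars false

/-! ## Tensor-triangulated categories -/

/-- A *tt-category*: an essentially small, idempotent-complete triangulated category `K` with a
symmetric monoidal structure such that every functor `x ⊗ -` is exact.

As usual, exactness of `x ⊗ -` comprises the isomorphisms `x ⊗ y⟦n⟧ ≅ (x ⊗ y)⟦n⟧`, natural in
`y`, with which `x ⊗ -` preserves distinguished triangles; they are natural in `x` as well and
compatible with the associator and the unitor of `⊗`. Exactness of `- ⊗ x` follows by symmetry.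

"Triangulated" is meant in Verdier's sense, so the stronger variants of the octahedral axiom
(morphism axiom for octahedra, higher triangles) are allowed but not demanded. -/
class TTCategory (K : Type u) [Category.{v} K] [Preadditive K] [HasZeroObject K] [HasShift K ℤ]
    [∀ n : ℤ, (shiftFunctor K n).Additive] [Pretriangulated K] [MonoidalCategory K]
    [SymmetricCategory K] where
  isTriangulated : IsTriangulated K
  essentiallySmall : EssentiallySmall.{v} K
  isIdempotentComplete : IsIdempotentComplete K
  /-- The isomorphisms `x ⊗ y⟦n⟧ ≅ (x ⊗ y)⟦n⟧`, natural in `y`. -/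
  commShift : ∀ x : K, (tensorLeft x).CommShift ℤ
  exact : ∀ x : K, (tensorLeft x).IsTriangulated
  naturality : ∀ {x y : K} (f : x ⟶ y), NatTrans.CommShift ((tensoringLeft K).map f) ℤ
  associativity : ∀ x y : K, NatTrans.CommShift (tensorLeftTensor x y).hom ℤ
  unitality : NatTrans.CommShift (leftUnitorNatIso K).hom ℤ

attribute [reducible] TTCategory.commShift

attribute [instance] TTCategory.isTriangulated TTCategory.essentiallySmall
  TTCategory.isIdempotentComplete TTCategory.commShift TTCategory.exact TTCategory.naturality
  TTCategory.associativity TTCategory.unitality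

/-! ## The spectrum -/

/-- The part of a tensor-triangular structure that thick tensor-ideals refer to: the
distinguished triangles and the tensor product of objects. There are two instances: a
tt-category and the category of modules over a tt-ring in it. -/
class TTData (C : Type u) [Category.{v} C] [HasShift C ℤ] where
  /-- the distinguished triangles -/
  dist : Set (Triangle C)
  /-- the tensor product of objects -/
  tensor : C → C → C

/-- Thick tensor-ideals: the full triangulated subcategories that are closed under direct
summands and under tensoring with arbitrary objects. -/
structure IsThickTensorIdeal {C : Type u} [Category.{v} C] [HasShift C ℤ] [TTData C]
    (J : ObjectProperty C) : Prop where
  zero : ∃ z : C, IsZero z ∧ J z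
  shift : ∀ (x : C) (n : ℤ), J x → J (x⟦n⟧)
  ext₁ : ∀ T ∈ TTData.dist (C := C), J T.obj₂ → J T.obj₃ → J T.obj₁
  ext₂ : ∀ T ∈ TTData.dist (C := C), J T.obj₁ → J T.obj₃ → J T.obj₂
  ext₃ : ∀ T ∈ TTData.dist (C := C), J T.obj₁ → J T.obj₂ → J T.obj₃
  /-- if `x` is a direct summand of `y ∈ J` then `x ∈ J`; in particular `J` is replete -/
  summand : ∀ x y : C, Retract x y → J y → J x
  tensor : ∀ x y : C, J y → J (TTData.tensor x y)

/-- The spectrum: the set of prime thick tensor-ideals. -/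
@[ext]
structure Spc (C : Type u) [Category.{v} C] [HasShift C ℤ] [TTData C] where
  /-- the objects that belong to the prime -/
  carrier : ObjectProperty C
  isThickTensorIdeal : IsThickTensorIdeal carrier
  proper : ∃ x : C, ¬ carrier x
  prime : ∀ x y : C, carrier (TTData.tensor x y) → carrier x ∨ carrier y

/-- Inclusion of primes. -/
instance {C : Type u} [Category.{v} C] [HasShift C ℤ] [TTData C] : LE (Spc C) where
  le P Q := P.carrier ≤ Q.carrier

/-- The topology of the spectrum, with the sets `U(x) = {P | x ∈ P}` as a basis of opens. -/
instance {C : Type u} [Category.{v} C] [HasShift C ℤ] [TTData C] : TopologicalSpace (Spc C) :=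
  TopologicalSpace.generateFrom {U | ∃ x : C, U = {P : Spc C | P.carrier x}}

/-- The distinguished triangles and the tensor product of a tt-category. -/
instance TTCategory.ttData (K : Type u) [Category.{v} K] [Preadditive K] [HasZeroObject K]
    [HasShift K ℤ] [∀ n : ℤ, (shiftFunctor K n).Additive] [Pretriangulated K]
    [MonoidalCategory K] [SymmetricCategory K] [TTCategory K] : TTData K where
  dist := distTriang K
  tensor x y := x ⊗ y

/-! ## tt-rings and their modules -/

/-- A ring object `A` is a *tt-ring* if it is commutative and separable, i.e. its multiplication
has a section `σ` that is `A`-linear on both sides. -/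
class IsTTRing {K : Type u} [Category.{v} K] [MonoidalCategory K] [SymmetricCategory K]
    (A : K) [MonObj A] : Prop extends IsCommMonObj A where
  separable : ∃ σ : A ⟶ A ⊗ A, σ ≫ μ[A] = 𝟙 A ∧
    σ ▷ A ≫ (α_ A A A).hom ≫ A ◁ μ[A] = μ[A] ≫ σ ∧
    A ◁ σ ≫ (α_ A A A).inv ≫ μ[A] ▷ A = μ[A] ≫ σ

namespace TTCategory

section Free

variable {K : Type u} [Category.{v} K] [MonoidalCategory K] (A : K) [MonObj A]

/-- The free `A`-module `A ⊗ y`, with action `μ ⊗ 1`. -/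
@[reducible]
def freeModObj (y : K) : ModObj A (A ⊗ y) where
  smul := (α_ A A y).inv ≫ μ[A] ▷ y
  one_smul := by
    change η[A] ▷ (A ⊗ y) ≫ (α_ A A y).inv ≫ μ[A] ▷ y = (λ_ (A ⊗ y)).hom
    rw [associator_inv_naturality_left_assoc, ← comp_whiskerRight, MonObj.one_mul]
    simp
  mul_smul := by
    change μ[A] ▷ (A ⊗ y) ≫ (α_ A A y).inv ≫ μ[A] ▷ y =
      (α_ A A (A ⊗ y)).hom ≫ A ◁ ((α_ A A y).inv ≫ μ[A] ▷ y) ≫ (α_ A A y).inv ≫ μ[A] ▷ y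
    rw [associator_inv_naturality_left_assoc, ← comp_whiskerRight, MonObj.mul_assoc]
    simp

/-- Extension of scalars `F_A : K ⥤ A-Mod`, `y ↦ (A ⊗ y, μ ⊗ 1)`. -/
def extendScalars : K ⥤ Mod K A where
  obj y := letI := freeModObj A y; ⟨A ⊗ y⟩
  map {y z} f :=
    letI := freeModObj A y
    letI := freeModObj A z
    Mod.Hom.mk'' (A ◁ f) (by
      change ((α_ A A y).inv ≫ μ[A] ▷ y) ≫ A ◁ f = A ◁ A ◁ f ≫ (α_ A A z).inv ≫ μ[A] ▷ z
      rw [Category.assoc, ← whisker_exchange, associator_inv_naturality_right_assoc])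
  map_id y := by ext; exact whiskerLeft_id _ _
  map_comp f g := by ext; exact whiskerLeft_comp _ _ _

/-- The action `A ⊗ x ⟶ x` of an `A`-module. -/
abbrev act (x : Mod K A) : A ⊗ x.X ⟶ x.X := x.mod.smul

end Free

section Auxiliary

variable {K : Type u} [Category.{v} K] [MonoidalCategory K] {A x y : K}

lemma balanced_aux (r : x ⊗ A ⟶ x) (m : A ⊗ A ⟶ A) (a : A ⊗ y ⟶ y) (s : y ⟶ A ⊗ y)
    (hr : r ▷ A ≫ r = (α_ x A A).hom ≫ x ◁ m ≫ r)
    (hs : a ≫ s = A ◁ s ≫ (α_ A A y).inv ≫ m ▷ y) :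
    r ▷ y ≫ (x ◁ s ≫ (α_ x A y).inv) ≫ r ▷ y =
      ((α_ x A y).hom ≫ x ◁ a) ≫ (x ◁ s ≫ (α_ x A y).inv) ≫ r ▷ y := by
  have h1 : r ▷ y ≫ x ◁ s = (x ⊗ A) ◁ s ≫ r ▷ (A ⊗ y) := (whisker_exchange r s).symm
  have h2 : r ▷ (A ⊗ y) ≫ (α_ x A y).inv = (α_ (x ⊗ A) A y).inv ≫ (r ▷ A) ▷ y := by simp
  have h3 : (r ▷ A) ▷ y ≫ r ▷ y = (α_ x A A).hom ▷ y ≫ (x ◁ m) ▷ y ≫ r ▷ y := by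
    rw [← comp_whiskerRight, hr]; simp
  have h4 : x ◁ a ≫ x ◁ s = x ◁ A ◁ s ≫ x ◁ (α_ A A y).inv ≫ x ◁ (m ▷ y) := by
    rw [← MonoidalCategory.whiskerLeft_comp, hs]; simp
  simp only [Category.assoc]
  rw [reassoc_of% h1, reassoc_of% h2, h3, reassoc_of% h4]
  simp

lemma linear_aux (r : x ⊗ A ⟶ x) (p : A ⊗ x ⟶ x) (s : y ⟶ A ⊗ y)
    (hr : p ▷ A ≫ r = (α_ A x A).hom ≫ A ◁ r ≫ p) :
    A ◁ ((x ◁ s ≫ (α_ x A y).inv) ≫ r ▷ y) ≫ (α_ A x y).inv ≫ p ▷ y =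
      ((α_ A x y).inv ≫ p ▷ y) ≫ (x ◁ s ≫ (α_ x A y).inv) ≫ r ▷ y := by
  have h1 : p ▷ y ≫ x ◁ s = (A ⊗ x) ◁ s ≫ p ▷ (A ⊗ y) := (whisker_exchange p s).symm
  have h2 : p ▷ (A ⊗ y) ≫ (α_ x A y).inv = (α_ (A ⊗ x) A y).inv ≫ (p ▷ A) ▷ y := by simp
  have h3 : (p ▷ A) ▷ y ≫ r ▷ y = (α_ A x A).hom ▷ y ≫ (A ◁ r) ▷ y ≫ p ▷ y := by
    rw [← comp_whiskerRight, hr]; simp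
  simp only [Category.assoc]
  rw [reassoc_of% h1, reassoc_of% h2, h3]
  simp

lemma tensorAct_one_aux [MonObj A] (p : A ⊗ x ⟶ x) (h : η[A] ▷ x ≫ p = (λ_ x).hom) :
    η[A] ▷ (x ⊗ y) ≫ (α_ A x y).inv ≫ p ▷ y = (λ_ (x ⊗ y)).hom := by
  rw [associator_inv_naturality_left_assoc, ← comp_whiskerRight, h]
  simp

lemma tensorAct_mul_aux [MonObj A] (p : A ⊗ x ⟶ x)
    (h : A ◁ p ≫ p = (α_ A A x).inv ≫ μ[A] ▷ x ≫ p) :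
    A ◁ ((α_ A x y).inv ≫ p ▷ y) ≫ (α_ A x y).inv ≫ p ▷ y =
      (α_ A A (x ⊗ y)).inv ≫ μ[A] ▷ (x ⊗ y) ≫ (α_ A x y).inv ≫ p ▷ y := by
  have h3 : (A ◁ p) ▷ y ≫ p ▷ y = (α_ A A x).inv ▷ y ≫ (μ[A] ▷ x) ▷ y ≫ p ▷ y := by
    rw [← comp_whiskerRight, h]; simp
  simp only [MonoidalCategory.whiskerLeft_comp, Category.assoc, associator_inv_naturality_middle_assoc]
  rw [h3]
  simp

lemma section_left_aux [MonObj A] (σ : A ⟶ A ⊗ A) (p : A ⊗ y ⟶ y)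
    (hp : A ◁ p ≫ p = (α_ A A y).inv ≫ μ[A] ▷ y ≫ p)
    (hσ : σ ▷ A ≫ (α_ A A A).hom ≫ A ◁ μ[A] = μ[A] ≫ σ) :
    p ≫ (λ_ y).inv ≫ (η[A] ≫ σ) ▷ y ≫ (α_ A A y).hom ≫ A ◁ p =
      σ ▷ y ≫ (α_ A A y).hom ≫ A ◁ p := by
  have h0 : (λ_ A).inv ≫ η[A] ▷ A ≫ σ ▷ A ≫ (α_ A A A).hom ≫ A ◁ μ[A] = σ := by
    rw [hσ, MonObj.one_mul_assoc]; simp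
  have h1 : (𝟙_ K) ◁ p ≫ (η[A] ≫ σ) ▷ y = (η[A] ≫ σ) ▷ (A ⊗ y) ≫ (A ⊗ A) ◁ p :=
    whisker_exchange _ _
  have h2 : A ◁ A ◁ p ≫ A ◁ p = A ◁ (α_ A A y).inv ≫ A ◁ μ[A] ▷ y ≫ A ◁ p := by
    rw [← MonoidalCategory.whiskerLeft_comp, hp]; simp
  conv_rhs => rw [← h0]
  rw [leftUnitor_inv_naturality_assoc, reassoc_of% h1, associator_naturality_right_assoc, h2]
  simp

lemma section_right_aux [MonObj A] (σ : A ⟶ A ⊗ A) (p : A ⊗ y ⟶ y)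
    (hσ : A ◁ σ ≫ (α_ A A A).inv ≫ μ[A] ▷ A = μ[A] ≫ σ) :
    A ◁ ((λ_ y).inv ≫ (η[A] ≫ σ) ▷ y ≫ (α_ A A y).hom ≫ A ◁ p) ≫ (α_ A A y).inv ≫ μ[A] ▷ y =
      σ ▷ y ≫ (α_ A A y).hom ≫ A ◁ p := by
  have h0 : (ρ_ A).inv ≫ A ◁ η[A] ≫ A ◁ σ ≫ (α_ A A A).inv ≫ μ[A] ▷ A = σ := by
    rw [hσ, MonObj.mul_one_assoc]; simp
  have h1 : (A ⊗ A) ◁ p ≫ μ[A] ▷ y = μ[A] ▷ (A ⊗ y) ≫ A ◁ p := whisker_exchange _ _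
  have h2 : A ◁ A ◁ p ≫ (α_ A A y).inv ≫ μ[A] ▷ y =
    (α_ A A (A ⊗ y)).inv ≫ μ[A] ▷ (A ⊗ y) ≫ A ◁ p := by
    rw [← h1]; simp
  conv_rhs => rw [← h0]
  simp only [MonoidalCategory.whiskerLeft_comp, Category.assoc, h2]
  simp

lemma split_one_aux [MonObj A] (m : A ⊗ x ⟶ x) (i : y ⟶ x) (p : x ⟶ y) (hip : i ≫ p = 𝟙 y)
    (h : η[A] ▷ x ≫ m = (λ_ x).hom) : η[A] ▷ y ≫ A ◁ i ≫ m ≫ p = (λ_ y).hom := by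
  rw [← whisker_exchange_assoc, reassoc_of% h, leftUnitor_naturality_assoc, hip, Category.comp_id]

lemma split_mul_aux [MonObj A] (m : A ⊗ x ⟶ x) (i : y ⟶ x) (p : x ⟶ y) (hip : i ≫ p = 𝟙 y)
    (hm : A ◁ m ≫ m = (α_ A A x).inv ≫ μ[A] ▷ x ≫ m)
    (he : A ◁ (p ≫ i) ≫ m = m ≫ p ≫ i) :
    μ[A] ▷ y ≫ A ◁ i ≫ m ≫ p =
      (α_ A A y).hom ≫ A ◁ (A ◁ i ≫ m ≫ p) ≫ A ◁ i ≫ m ≫ p := by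
  have h : A ◁ p ≫ A ◁ i ≫ m ≫ p = m ≫ p := by
    rw [← whiskerLeft_comp_assoc, reassoc_of% he, hip, Category.comp_id]
  simp only [MonoidalCategory.whiskerLeft_comp, Category.assoc, h, reassoc_of% hm]
  rw [← whisker_exchange_assoc]
  simp

lemma free_tensor_aux (r : x ⊗ A ⟶ x) (m : A ⊗ A ⟶ A)
    (hr : r ▷ A ≫ r = (α_ x A A).hom ≫ x ◁ m ≫ r) :
    r ▷ (A ⊗ y) ≫ (α_ x A y).inv ≫ r ▷ y =
      ((α_ x A (A ⊗ y)).hom ≫ x ◁ ((α_ A A y).inv ≫ m ▷ y)) ≫ (α_ x A y).inv ≫ r ▷ y := by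
  have h : (r ▷ A) ▷ y ≫ r ▷ y = (α_ x A A).hom ▷ y ≫ (x ◁ m) ▷ y ≫ r ▷ y := by
    rw [← comp_whiskerRight, hr]; simp
  rw [associator_inv_naturality_left_assoc, h]
  simp

lemma free_tensor_aux' [MonObj A] {z : K} (r : x ⊗ A ⟶ x) (k : x ⊗ (A ⊗ y) ⟶ z)
    (hk : r ▷ (A ⊗ y) ≫ k = ((α_ x A (A ⊗ y)).hom ≫ x ◁ ((α_ A A y).inv ≫ μ[A] ▷ y)) ≫ k) :
    ((α_ x A y).inv ≫ r ▷ y) ≫ x ◁ ((λ_ y).inv ≫ η[A] ▷ y) ≫ k = k := by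
  have h : A ◁ ((λ_ y).inv ≫ η[A] ▷ y) ≫ (α_ A A y).inv ≫ μ[A] ▷ y = 𝟙 _ := by
    have h0 : (A ◁ η[A]) ▷ y ≫ μ[A] ▷ y = (ρ_ A).hom ▷ y := by
      rw [← comp_whiskerRight, MonObj.mul_one]
    rw [MonoidalCategory.whiskerLeft_comp, Category.assoc,
      associator_inv_naturality_middle_assoc, h0]
    simp
  rw [Category.assoc, ← whisker_exchange_assoc, hk]
  simp only [Category.assoc, tensor_whiskerLeft, Iso.inv_hom_id_assoc]
  rw [← whiskerLeft_comp_assoc, h]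
  simp

lemma free_tensor_aux'' (r : x ⊗ A ⟶ x) (p : A ⊗ x ⟶ x)
    (hr : p ▷ A ≫ r = (α_ A x A).hom ≫ A ◁ r ≫ p) :
    ((α_ A x (A ⊗ y)).inv ≫ p ▷ (A ⊗ y)) ≫ (α_ x A y).inv ≫ r ▷ y =
      A ◁ ((α_ x A y).inv ≫ r ▷ y) ≫ (α_ A x y).inv ≫ p ▷ y := by
  have h : (p ▷ A) ▷ y ≫ r ▷ y = (α_ A x A).hom ▷ y ≫ (A ◁ r) ▷ y ≫ p ▷ y := by
    rw [← comp_whiskerRight, hr]; simp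
  rw [Category.assoc, associator_inv_naturality_left_assoc, h]
  simp

end Auxiliary

section Modules

variable {K : Type u} [Category.{v} K] [Preadditive K] [HasZeroObject K] [HasShift K ℤ]
  [∀ n : ℤ, (shiftFunctor K n).Additive] [Pretriangulated K] [MonoidalCategory K]
  [SymmetricCategory K] [TTCategory K]

/-- The isomorphism `x ⊗ y⟦n⟧ ≅ (x ⊗ y)⟦n⟧`. -/
noncomputable def tensorShiftIso (x y : K) (n : ℤ) : x ⊗ y⟦n⟧ ≅ (x ⊗ y)⟦n⟧ :=
  ((tensorLeft x).commShiftIso n).app y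

lemma tensorShiftIso_natural_right (x : K) {y z : K} (f : y ⟶ z) (n : ℤ) :
    x ◁ f⟦n⟧' ≫ (tensorShiftIso x z n).hom = (tensorShiftIso x y n).hom ≫ (x ◁ f)⟦n⟧' :=
  ((tensorLeft x).commShiftIso n).hom.naturality f

lemma tensorShiftIso_natural_left {x y : K} (f : x ⟶ y) (z : K) (n : ℤ) :
    f ▷ z⟦n⟧ ≫ (tensorShiftIso y z n).hom = (tensorShiftIso x z n).hom ≫ (f ▷ z)⟦n⟧' :=
  (NatTrans.shift_app_comm ((tensoringLeft K).map f) n z).symm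

lemma tensorShiftIso_assoc (x y z : K) (n : ℤ) :
    (tensorShiftIso (x ⊗ y) z n).hom ≫ (α_ x y z).hom⟦n⟧' =
      (α_ x y (z⟦n⟧)).hom ≫ x ◁ (tensorShiftIso y z n).hom ≫
        (tensorShiftIso x (y ⊗ z) n).hom := by
  have h := NatTrans.shift_app_comm (tensorLeftTensor x y).hom n z
  rw [Functor.commShiftIso_comp_hom_app] at h
  exact h

lemma tensorShiftIso_unit (z : K) (n : ℤ) :
    (tensorShiftIso (𝟙_ K) z n).hom ≫ (λ_ z).hom⟦n⟧' = (λ_ (z⟦n⟧)).hom := by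
  have h := NatTrans.shift_app_comm (leftUnitorNatIso K).hom n z
  rw [Functor.commShiftIso_id_hom_app] at h
  exact h.trans (Category.comp_id _)

variable (A : K) [MonObj A]

/-- The `A`-module structure on a shift: `A ⊗ x⟦n⟧ ≅ (A ⊗ x)⟦n⟧ ⟶ x⟦n⟧`. -/
@[reducible]
noncomputable def shiftModObj (x : Mod K A) (n : ℤ) : ModObj A (x.X⟦n⟧) where
  smul := (tensorShiftIso A x.X n).hom ≫ (act A x)⟦n⟧'
  one_smul := by
    change η[A] ▷ (x.X⟦n⟧) ≫ (tensorShiftIso A x.X n).hom ≫ (act A x)⟦n⟧' = (λ_ (x.X⟦n⟧)).hom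
    rw [reassoc_of% @tensorShiftIso_natural_left, ← Functor.map_comp, ModObj.one_smul_self,
      tensorShiftIso_unit]
  mul_smul := by
    change μ[A] ▷ (x.X⟦n⟧) ≫ (tensorShiftIso A x.X n).hom ≫ (act A x)⟦n⟧' =
      (α_ A A (x.X⟦n⟧)).hom ≫ A ◁ ((tensorShiftIso A x.X n).hom ≫ (act A x)⟦n⟧') ≫
        (tensorShiftIso A x.X n).hom ≫ (act A x)⟦n⟧'
    rw [reassoc_of% @tensorShiftIso_natural_left, ← Functor.map_comp, ModObj.mul_smul_self,
      Functor.map_comp, reassoc_of% @tensorShiftIso_assoc]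
    simp only [Functor.map_comp, MonoidalCategory.whiskerLeft_comp, Category.assoc,
      reassoc_of% @tensorShiftIso_natural_right]

/-- The shift by `n` on `A`-modules. -/
noncomputable def modShiftFunctor (n : ℤ) : Mod K A ⥤ Mod K A where
  obj x := letI := shiftModObj A x n; ⟨x.X⟦n⟧⟩
  map {x y} f :=
    letI := shiftModObj A x n
    letI := shiftModObj A y n
    Mod.Hom.mk'' (f.hom⟦n⟧') (by
      change ((tensorShiftIso A x.X n).hom ≫ (act A x)⟦n⟧') ≫ f.hom⟦n⟧' =
        A ◁ f.hom⟦n⟧' ≫ (tensorShiftIso A y.X n).hom ≫ (act A y)⟦n⟧'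
      have h : act A x ≫ f.hom = A ◁ f.hom ≫ act A y := f.isModHom.smul_hom
      rw [Category.assoc, ← Functor.map_comp, h, Functor.map_comp,
        reassoc_of% @tensorShiftIso_natural_right])
  map_id x := by ext; exact (shiftFunctor K n).map_id _
  map_comp f g := by ext; exact (shiftFunctor K n).map_comp _ _

variable {A} in
/-- An isomorphism of underlying objects that respects the actions is one of modules. -/
def modIso {x y : Mod K A} (e : x.X ≅ y.X) (h : act A x ≫ e.hom = A ◁ e.hom ≫ act A y) :
    x ≅ y where
  hom := Mod.Hom.mk' e.hom h
  inv := Mod.Hom.mk' e.inv (by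
    change act A y ≫ e.inv = A ◁ e.inv ≫ act A x
    rw [Iso.comp_inv_eq, Category.assoc, h, ← whiskerLeft_comp_assoc, e.inv_hom_id]
    simp)
  hom_inv_id := by ext; exact e.hom_inv_id
  inv_hom_id := by ext; exact e.inv_hom_id

lemma tensorShiftIso_zero (x y : K) :
    (tensorShiftIso x y 0).hom ≫ (shiftFunctorZero K ℤ).hom.app (x ⊗ y) =
      x ◁ (shiftFunctorZero K ℤ).hom.app y := by
  change ((tensorLeft x).commShiftIso (0 : ℤ)).hom.app y ≫ _ = _
  rw [Functor.commShiftIso_zero, Functor.CommShift.isoZero_hom_app, Category.assoc]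
  erw [Iso.inv_hom_id_app]
  exact Category.comp_id _

lemma tensorShiftIso_add (x y : K) (n m : ℤ) :
    (tensorShiftIso x y (n + m)).hom ≫ (shiftFunctorAdd K n m).hom.app (x ⊗ y) =
      x ◁ (shiftFunctorAdd K n m).hom.app y ≫ (tensorShiftIso x (y⟦n⟧) m).hom ≫
        (tensorShiftIso x y n).hom⟦m⟧' := by
  change ((tensorLeft x).commShiftIso (n + m)).hom.app y ≫ _ = _
  rw [Functor.commShiftIso_add, Functor.CommShift.isoAdd_hom_app]
  simp only [Category.assoc]
  erw [Iso.inv_hom_id_app, Category.comp_id]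
  rfl

@[simp]
lemma mod_eqToHom_hom {x y : Mod K A} (h : x = y) :
    (eqToHom h).hom = eqToHom (congrArg Mod.X h) := by
  subst h
  rfl

/-- The structure isomorphisms of the shift of `A`-modules are those of `K`. -/
noncomputable def modShiftCore : ShiftMkCore (Mod K A) ℤ where
  F := modShiftFunctor A
  zero := NatIso.ofComponents
    (fun x => modIso ((shiftFunctorZero K ℤ).app x.X) (by
      change ((tensorShiftIso A x.X 0).hom ≫ (act A x)⟦(0 : ℤ)⟧') ≫
        (shiftFunctorZero K ℤ).hom.app x.X = A ◁ (shiftFunctorZero K ℤ).hom.app x.X ≫ act A x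
      rw [← tensorShiftIso_zero, Category.assoc, Category.assoc]
      exact congrArg _ ((shiftFunctorZero K ℤ).hom.naturality (act A x))))
    (fun f => by
      ext
      exact (shiftFunctorZero K ℤ).hom.naturality f.hom)
  add n m := NatIso.ofComponents
    (fun x => modIso ((shiftFunctorAdd K n m).app x.X) (by
      change ((tensorShiftIso A x.X (n + m)).hom ≫ (act A x)⟦n + m⟧') ≫
        (shiftFunctorAdd K n m).hom.app x.X = A ◁ (shiftFunctorAdd K n m).hom.app x.X ≫
          (tensorShiftIso A (x.X⟦n⟧) m).hom ≫ ((tensorShiftIso A x.X n).hom ≫ (act A x)⟦n⟧')⟦m⟧'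
      have h := (shiftFunctorAdd K n m).hom.naturality (act A x)
      rw [Category.assoc, h, ← Category.assoc, tensorShiftIso_add, Functor.map_comp]
      simp only [Category.assoc]
      rfl))
    (fun f => by
      ext
      exact (shiftFunctorAdd K n m).hom.naturality f.hom)
  assoc_hom_app a b c x := by
    ext
    simp only [Mod.comp_hom', mod_eqToHom_hom]
    have h := shiftFunctorAdd_assoc_hom_app a b c x.X
    simp only [shiftFunctorAdd', Iso.trans_hom, eqToIso.hom, NatTrans.comp_app, eqToHom_app,
      Category.assoc] at h
    exact h
  zero_add_hom_app n x := by
    ext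
    simp only [Mod.comp_hom', mod_eqToHom_hom]
    have h := shiftFunctorAdd_zero_add_hom_app n x.X
    exact h
  add_zero_hom_app n x := by
    ext
    simp only [Mod.comp_hom', mod_eqToHom_hom]
    have h := shiftFunctorAdd_add_zero_hom_app n x.X
    exact h

noncomputable instance : HasShift (Mod K A) ℤ := hasShiftMk _ _ (modShiftCore A)

lemma shift_X (x : Mod K A) (n : ℤ) : (x⟦n⟧).X = x.X⟦n⟧ := rfl

/-- The triangle in `K` that underlies a triangle of `A`-modules. -/
noncomputable def underlyingTriangle (T : Triangle (Mod K A)) : Triangle K :=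
  Triangle.mk T.mor₁.hom T.mor₂.hom (show T.obj₃.X ⟶ T.obj₁.X⟦(1 : ℤ)⟧ from T.mor₃.hom)

/-- The right action `x ⊗ A ⟶ x` on an `A`-module, obtained from the left one by the symmetry. -/
abbrev ract (x : Mod K A) : x.X ⊗ A ⟶ x.X := (β_ x.X A).hom ≫ act A x

/-- The two maps `(x ⊗ A) ⊗ y ⇉ x ⊗ y` whose coequalizer is `x ⊗_A y`. -/
abbrev balLeft (x y : Mod K A) : (x.X ⊗ A) ⊗ y.X ⟶ x.X ⊗ y.X := ract A x ▷ y.X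

/-- The second of the two maps whose coequalizer is `x ⊗_A y`. -/
abbrev balRight (x y : Mod K A) : (x.X ⊗ A) ⊗ y.X ⟶ x.X ⊗ y.X :=
  (α_ x.X A y.X).hom ≫ x.X ◁ act A y

/-- The action of `A` on `x ⊗ y` through `x`. -/
abbrev tensorAct (x y : Mod K A) : A ⊗ (x.X ⊗ y.X) ⟶ x.X ⊗ y.X :=
  (α_ A x.X y.X).inv ≫ act A x ▷ y.X

/-- A tensor product of `x` and `y` over `A`: an `A`-module `obj` with an `A`-linear map
`π : x ⊗ y ⟶ obj` that is the coequalizer in `K` of the two maps `(x ⊗ A) ⊗ y ⇉ x ⊗ y`. -/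
structure RelTensor (x y : Mod K A) where
  obj : Mod K A
  π : x.X ⊗ y.X ⟶ obj.X
  condition : balLeft A x y ≫ π = balRight A x y ≫ π
  isColimit : IsColimit (Cofork.ofπ π condition)
  linear : tensorAct A x y ≫ π = A ◁ π ≫ act A obj

lemma act_assoc (x : Mod K A) : A ◁ act A x ≫ act A x = (α_ A A x.X).inv ≫ μ[A] ▷ x.X ≫ act A x :=
  ModObj.mul_smul_self_flip x.X

lemma act_one (x : Mod K A) : η[A] ▷ x.X ≫ act A x = (λ_ x.X).hom :=
  ModObj.one_smul_self A x.X

lemma ract_assoc [IsCommMonObj A] (x : Mod K A) :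
    ract A x ▷ A ≫ ract A x = (α_ x.X A A).hom ≫ x.X ◁ μ[A] ≫ ract A x := by
  have h : x.X ◁ μ[A] ≫ (β_ x.X A).hom = (β_ x.X (A ⊗ A)).hom ≫ μ[A] ▷ x.X :=
    BraidedCategory.braiding_naturality_right _ _
  have h' : ract A x ▷ A ≫ (β_ x.X A).hom = (β_ (x.X ⊗ A) A).hom ≫ A ◁ ract A x :=
    BraidedCategory.braiding_naturality_left _ _
  rw [reassoc_of% h', MonoidalCategory.whiskerLeft_comp, Category.assoc, act_assoc,
    ← IsCommMonObj.mul_comm A, MonoidalCategory.whiskerLeft_comp, Category.assoc, reassoc_of% h,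
    IsCommMonObj.mul_comm A, BraidedCategory.braiding_tensor_left_hom,
    BraidedCategory.braiding_tensor_right_hom]
  simp

lemma ract_linear [IsCommMonObj A] (x : Mod K A) :
    act A x ▷ A ≫ ract A x = (α_ A x.X A).hom ≫ A ◁ ract A x ≫ act A x := by
  have h' : act A x ▷ A ≫ (β_ x.X A).hom = (β_ (A ⊗ x.X) A).hom ≫ A ◁ act A x :=
    BraidedCategory.braiding_naturality_left _ _
  have h : (β_ A A).hom ▷ x.X ≫ μ[A] ▷ x.X = μ[A] ▷ x.X := by
    rw [← comp_whiskerRight, IsCommMonObj.mul_comm]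
  rw [reassoc_of% h', MonoidalCategory.whiskerLeft_comp, Category.assoc, act_assoc,
    BraidedCategory.braiding_tensor_left_hom]
  simp only [Category.assoc, Iso.hom_inv_id_assoc, reassoc_of% h]

lemma ract_one (x : Mod K A) : x.X ◁ η[A] ≫ ract A x = (ρ_ x.X).hom := by
  rw [← Category.assoc, BraidedCategory.braiding_naturality_right, Category.assoc, act_one]
  simp

/-- Separability: every action map has an `A`-linear section. -/
lemma exists_section [IsTTRing A] (y : Mod K A) : ∃ s : y.X ⟶ A ⊗ y.X,
    s ≫ act A y = 𝟙 _ ∧ act A y ≫ s = A ◁ s ≫ (α_ A A y.X).inv ≫ μ[A] ▷ y.X := by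
  obtain ⟨σ, h₁, h₂, h₃⟩ := IsTTRing.separable (A := A)
  refine ⟨(λ_ y.X).inv ≫ (η[A] ≫ σ) ▷ y.X ≫ (α_ A A y.X).hom ≫ A ◁ act A y, ?_,
    (section_left_aux σ _ (act_assoc A y) h₂).trans (section_right_aux σ _ h₃).symm⟩
  simp only [Category.assoc, act_assoc, Iso.hom_inv_id_assoc]
  rw [← comp_whiskerRight_assoc, Category.assoc, h₁, Category.comp_id, act_one]
  simp

/-- The idempotent on `x ⊗ y` whose image is `x ⊗_A y`. -/
lemma exists_idempotent [IsTTRing A] (x y : Mod K A) : ∃ e : x.X ⊗ y.X ⟶ x.X ⊗ y.X,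
    balLeft A x y ≫ e = balRight A x y ≫ e ∧
    (∀ {z : K} (k : x.X ⊗ y.X ⟶ z), balLeft A x y ≫ k = balRight A x y ≫ k → e ≫ k = k) ∧
    A ◁ e ≫ tensorAct A x y = tensorAct A x y ≫ e := by
  obtain ⟨s, hs, hs'⟩ := exists_section A y
  have hs'' : (x.X ◁ s ≫ (α_ x.X A y.X).inv) ≫ balRight A x y = 𝟙 _ := by
    simp only [Category.assoc, Iso.inv_hom_id_assoc, ← MonoidalCategory.whiskerLeft_comp, hs,
      MonoidalCategory.whiskerLeft_id]
  refine ⟨(x.X ◁ s ≫ (α_ x.X A y.X).inv) ≫ balLeft A x y,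
    balanced_aux (ract A x) μ[A] (act A y) s (ract_assoc A x) hs', fun k hk => ?_,
    linear_aux (ract A x) (act A x) s (ract_linear A x)⟩
  rw [Category.assoc, hk, ← Category.assoc, hs'', Category.id_comp]

/-- The tensor product over a tt-ring exists. -/
lemma nonempty_relTensor [IsTTRing A] (x y : Mod K A) : Nonempty (RelTensor A x y) := by
  obtain ⟨e, he, hek, hlin⟩ := exists_idempotent A x y
  obtain ⟨z, i, p, hip, hpi⟩ := IsIdempotentComplete.idempotents_split _ e (hek e he)
  have hep : e ≫ p = p := by rw [← hpi, Category.assoc, hip, Category.comp_id]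
  have hc : balLeft A x y ≫ p = balRight A x y ≫ p := by
    rw [← hep, ← Category.assoc, he, Category.assoc]
  have hAp : A ◁ p ≫ A ◁ i ≫ tensorAct A x y ≫ p = tensorAct A x y ≫ p := by
    rw [← whiskerLeft_comp_assoc, hpi, ← Category.assoc, hlin, Category.assoc, hep]
  have h₁ : η[A] ▷ (x.X ⊗ y.X) ≫ tensorAct A x y = (λ_ (x.X ⊗ y.X)).hom :=
    tensorAct_one_aux _ (act_one A x)
  have h₂ : A ◁ tensorAct A x y ≫ tensorAct A x y =
      (α_ A A (x.X ⊗ y.X)).inv ≫ μ[A] ▷ (x.X ⊗ y.X) ≫ tensorAct A x y :=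
    tensorAct_mul_aux _ (act_assoc A x)
  let m : ModObj A z := {
    smul := A ◁ i ≫ tensorAct A x y ≫ p
    one_smul := split_one_aux _ i p hip h₁
    mul_smul := split_mul_aux _ i p hip h₂ (by rw [hpi]; exact hlin) }
  refine ⟨⟨⟨z⟩, p, hc, Cofork.IsColimit.mk _ (fun k => i ≫ k.π) ?_ ?_, hAp.symm⟩⟩
  · intro k
    change p ≫ i ≫ k.π = k.π
    rw [← Category.assoc, hpi, hek _ k.condition]
  · intro k l hl
    change p ≫ l = k.π at hl
    rw [← hl, reassoc_of% hip]

/-- The tensor product `x ⊗_A y` of `A`-modules. -/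
noncomputable def relTensor [IsTTRing A] (x y : Mod K A) : RelTensor A x y :=
  (nonempty_relTensor A x y).some

/-- The tt-structure of the category of `A`-modules: a triangle is distinguished if and only if
the underlying triangle in `K` is, and the tensor product is that over `A`. -/
noncomputable instance ttDataMod [IsTTRing A] : TTData (Mod K A) where
  dist := {T | underlyingTriangle A T ∈ distTriang K}
  tensor x y := (relTensor A x y).obj

/-! ## Extension of scalars on spectra -/

lemma RelTensor.nonempty_iso [IsTTRing A] {x y : Mod K A} (R R' : RelTensor A x y) :
    Nonempty (R.obj ≅ R'.obj) := by
  let e : R.obj.X ≅ R'.obj.X := R.isColimit.coconePointUniqueUpToIso R'.isColimit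
  have he : R.π ≫ e.hom = R'.π := R.isColimit.comp_coconePointUniqueUpToIso_hom R'.isColimit
    WalkingParallelPair.one
  obtain ⟨f, hf, hfk, -⟩ := exists_idempotent A x y
  obtain ⟨i, hi'⟩ : ∃ i : R.obj.X ⟶ x.X ⊗ y.X, R.π ≫ i = f :=
    ⟨_, (Cofork.IsColimit.desc' R.isColimit f hf).2⟩
  have hi : i ≫ R.π = 𝟙 R.obj.X := by
    refine Cofork.IsColimit.hom_ext R.isColimit ?_
    change R.π ≫ i ≫ R.π = R.π ≫ 𝟙 R.obj.X
    rw [← Category.assoc, hi', hfk _ R.condition, Category.comp_id]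
  refine ⟨modIso e ?_⟩
  have hAi : A ◁ i ≫ A ◁ R.π = 𝟙 _ := by
    rw [← MonoidalCategory.whiskerLeft_comp, hi, MonoidalCategory.whiskerLeft_id]
  have h := R'.linear
  rw [← he, MonoidalCategory.whiskerLeft_comp, ← Category.assoc, R.linear] at h
  have h' := congrArg (A ◁ i ≫ ·) h
  simp only [Category.assoc] at h'
  rw [reassoc_of% hAi, reassoc_of% hAi] at h'
  exact h'

/-- The `A`-module `x ⊗ y` for an `A`-module `x` and an object `y` of `K`. -/
noncomputable def modTensor (x : Mod K A) (y : K) : Mod K A :=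
  letI : ModObj A (x.X ⊗ y) := {
    smul := (α_ A x.X y).inv ≫ act A x ▷ y
    one_smul := tensorAct_one_aux _ (act_one A x)
    mul_smul := by
      have h := tensorAct_mul_aux (y := y) _ (act_assoc A x)
      change _ = (α_ A A (x.X ⊗ y)).hom ≫ A ◁ ((α_ A x.X y).inv ≫ act A x ▷ y) ≫
        (α_ A x.X y).inv ≫ act A x ▷ y
      rw [h]
      exact (Iso.hom_inv_id_assoc _ _).symm }
  ⟨x.X ⊗ y⟩

lemma projection_formula [IsTTRing A] (x : Mod K A) (y : K) :
    Nonempty ((relTensor A x ((extendScalars A).obj y)).obj ≅ modTensor A x y) := by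
  have hc : balLeft A x ((extendScalars A).obj y) ≫ (α_ x.X A y).inv ≫ ract A x ▷ y =
      balRight A x ((extendScalars A).obj y) ≫ (α_ x.X A y).inv ≫ ract A x ▷ y :=
    free_tensor_aux _ _ (ract_assoc A x)
  refine RelTensor.nonempty_iso A _ ⟨modTensor A x y, (α_ x.X A y).inv ≫ ract A x ▷ y, hc,
    Cofork.IsColimit.mk _ (fun k => x.X ◁ ((λ_ y).inv ≫ η[A] ▷ y) ≫ k.π) ?_ ?_, ?_⟩
  · intro k
    exact free_tensor_aux' (ract A x) k.π k.condition
  · intro k l hl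
    have hl' : ((α_ x.X A y).inv ≫ ract A x ▷ y) ≫ l = k.π := hl
    have h : x.X ◁ ((λ_ y).inv ≫ η[A] ▷ y) ≫ (α_ x.X A y).inv ≫ ract A x ▷ y = 𝟙 _ := by
      have h0 : (x.X ◁ η[A]) ▷ y ≫ ract A x ▷ y = (ρ_ x.X).hom ▷ y := by
        rw [← comp_whiskerRight, ract_one]
      rw [MonoidalCategory.whiskerLeft_comp, Category.assoc,
        associator_inv_naturality_middle_assoc, h0]
      simp
    have h' : ∀ {w : K} (m : x.X ⊗ y ⟶ w), m =
        x.X ◁ ((λ_ y).inv ≫ η[A] ▷ y) ≫ ((α_ x.X A y).inv ≫ ract A x ▷ y) ≫ m := by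
      intro w m
      rw [← Category.assoc, h, Category.id_comp]
    exact (h' l).trans (congrArg (x.X ◁ ((λ_ y).inv ≫ η[A] ▷ y) ≫ ·) hl')
  · exact free_tensor_aux'' _ _ (ract_linear A x)

lemma nonempty_tensor_unit [IsTTRing A] (x : Mod K A) :
    Nonempty ((relTensor A x ((extendScalars A).obj (𝟙_ K))).obj ≅ x) := by
  obtain ⟨e⟩ := projection_formula A x (𝟙_ K)
  exact ⟨e ≪≫ modIso (ρ_ x.X) (by
    change ((α_ A x.X (𝟙_ K)).inv ≫ act A x ▷ 𝟙_ K) ≫ (ρ_ x.X).hom =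
      A ◁ (ρ_ x.X).hom ≫ act A x
    simp)⟩

lemma nonempty_extendScalars_tensor [IsTTRing A] (x y : K) :
    Nonempty ((relTensor A ((extendScalars A).obj x) ((extendScalars A).obj y)).obj ≅
      (extendScalars A).obj (x ⊗ y)) := by
  obtain ⟨e⟩ := projection_formula A ((extendScalars A).obj x) y
  exact ⟨e ≪≫ modIso (α_ A x y) (by
    change ((α_ A (A ⊗ x) y).inv ≫ ((α_ A A x).inv ≫ μ[A] ▷ x) ▷ y) ≫ (α_ A x y).hom =
      A ◁ (α_ A x y).hom ≫ (α_ A A (x ⊗ y)).inv ≫ μ[A] ▷ (x ⊗ y)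
    simp)⟩

/-- Extension of scalars commutes with shifts. -/
noncomputable def extendScalarsShiftIso (x : K) (n : ℤ) :
    (extendScalars A).obj (x⟦n⟧) ≅ ((extendScalars A).obj x)⟦n⟧ :=
  modIso (tensorShiftIso A x n) (by
    change ((α_ A A (x⟦n⟧)).inv ≫ μ[A] ▷ (x⟦n⟧)) ≫ (tensorShiftIso A x n).hom =
      A ◁ (tensorShiftIso A x n).hom ≫ (tensorShiftIso A (A ⊗ x) n).hom ≫
        ((α_ A A x).inv ≫ μ[A] ▷ x)⟦n⟧'
    have h : A ◁ (tensorShiftIso A x n).hom ≫ (tensorShiftIso A (A ⊗ x) n).hom ≫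
        ((α_ A A x).inv)⟦n⟧' = (α_ A A (x⟦n⟧)).inv ≫ (tensorShiftIso (A ⊗ A) x n).hom := by
      rw [Iso.eq_inv_comp, ← reassoc_of% @tensorShiftIso_assoc, ← Functor.map_comp, Iso.hom_inv_id,
        CategoryTheory.Functor.map_id]
      exact Category.comp_id _
    rw [Category.assoc, tensorShiftIso_natural_left, Functor.map_comp, reassoc_of% h])

/-- The image of a triangle under extension of scalars. -/
noncomputable def extendScalarsTriangle (T : Triangle K) : Triangle (Mod K A) :=
  Triangle.mk ((extendScalars A).map T.mor₁) ((extendScalars A).map T.mor₂)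
    ((extendScalars A).map T.mor₃ ≫ (extendScalarsShiftIso A T.obj₁ 1).hom)

lemma extendScalarsTriangle_dist [IsTTRing A] (T : Triangle K) (hT : T ∈ distTriang K) :
    extendScalarsTriangle A T ∈ TTData.dist (C := Mod K A) :=
  (tensorLeft A).map_distinguished T hT

end Modules

end TTCategory

open TTCategory in
/-- The map `φ_A = Spc(F_A) : Spc(A-Mod) → Spc(K)`, `Q ↦ F_A⁻¹(Q)`. -/
noncomputable def Spc.extendScalars {K : Type u} [Category.{v} K] [Preadditive K]
    [HasZeroObject K] [HasShift K ℤ] [∀ n : ℤ, (shiftFunctor K n).Additive] [Pretriangulated K]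
    [MonoidalCategory K] [SymmetricCategory K] [TTCategory K] (A : K) [MonObj A] [IsTTRing A]
    (Q : Spc (Mod K A)) : Spc K where
  carrier := Q.carrier.inverseImage (TTCategory.extendScalars A)
  isThickTensorIdeal := by
    have hQ := Q.isThickTensorIdeal
    have iso {x y : Mod K A} (e : x ≅ y) (h : Q.carrier y) : Q.carrier x :=
      hQ.summand x y e.retract h
    exact {
      zero := by
        obtain ⟨z, hz, hQz⟩ := hQ.zero
        obtain ⟨o, ho⟩ := HasZeroObject.zero (C := K)
        have h0 : IsZero (A ⊗ o) := (tensorLeft A).map_isZero ho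
        have h1 : IsZero ((TTCategory.extendScalars A).obj o) := by
          refine ⟨fun w => ⟨⟨⟨Mod.Hom.mk' (h0.to_ w.X) ?_⟩, fun f => ?_⟩⟩,
            fun w => ⟨⟨⟨Mod.Hom.mk' (h0.from_ w.X) ?_⟩, fun f => ?_⟩⟩⟩
          · exact ((tensorLeft A).map_isZero h0).eq_of_src _ _
          · ext
            exact h0.eq_of_src _ _
          · exact h0.eq_of_tgt _ _
          · ext
            exact h0.eq_of_tgt _ _
        exact ⟨o, ho, iso (h1.iso hz) hQz⟩
      shift := fun x n h => iso (extendScalarsShiftIso A x n) (hQ.shift _ n h)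
      ext₁ := fun T hT => hQ.ext₁ _ (extendScalarsTriangle_dist A T hT)
      ext₂ := fun T hT => hQ.ext₂ _ (extendScalarsTriangle_dist A T hT)
      ext₃ := fun T hT => hQ.ext₃ _ (extendScalarsTriangle_dist A T hT)
      summand := fun x y r h => hQ.summand _ _ (r.map (TTCategory.extendScalars A)) h
      tensor := fun x y h =>
        iso (nonempty_extendScalars_tensor A x y).some.symm (hQ.tensor _ _ h) }
  proper := by
    obtain ⟨x, hx⟩ := Q.proper
    refine ⟨𝟙_ K, fun h => hx ?_⟩
    exact Q.isThickTensorIdeal.summand _ _ (nonempty_tensor_unit A x).some.symm.retract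
      (Q.isThickTensorIdeal.tensor x _ h)
  prime x y h := Q.prime _ _ (Q.isThickTensorIdeal.summand _ _
    (nonempty_extendScalars_tensor A x y).some.retract h)

/-! Write F for `extendScalars A`, U for the underlying object, x ⊗ s for the module `modTensor A x
s` (which is x ⊗_A F(s) by the projection formula), and P for the smaller prime, so that P ⊆ F⁻¹(Q).
The proof is the tensor-triangular form of the classical argument with an ideal avoiding a
multiplicative set.

Consider the thick ⊗-ideals I of modules that avoid all x ⊗ s with x ∉ Q and s ∉ P. One of them is
I₀ = {x | U(x) ∈ P}: if U(x) ⊗ s ∈ P, then s ∈ P, or U(x) ∈ P and hence F(U(x)) ∈ Q, which forces x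
∈ Q because x is a direct summand of F(U(x)). Zorn's lemma gives a maximal such I above I₀. The
avoided modules are closed under ⊗_A up to isomorphism, so I is prime (`prime_of_maximal`). Taking s
= 𝟙 shows I ⊆ Q. If y ∈ P then U(F(y)) = A ⊗ y ∈ P, so F(y) ∈ I₀ ⊆ I; conversely F(y) ≅ F(𝟙) ⊗ y ∈ I
and F(𝟙) ∉ Q force y ∈ P. Thus F⁻¹(I) = P.

Primality needs the quotient {x | b ⊗_A x ∈ I} to be a thick ⊗-ideal
(`isThickTensorIdeal_quotient`), hence the exactness of b ⊗_A -. This is where separability enters: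
a single bilinear section of μ makes b ⊗_A - a natural direct summand of b ⊗ -, compatibly with
shifts, and retracts of distinguished triangles are distinguished (`distinguished_of_retract`). It
also makes every module a summand of a free one. -/

namespace TTCategory

/-! ## Retracts of distinguished triangles -/

section RetractTriangle

variable {C : Type u} [Category.{v} C] [Preadditive C] [HasZeroObject C] [HasShift C ℤ]
  [∀ n : ℤ, (shiftFunctor C n).Additive] [Pretriangulated C]

/-- Write `φ.hom₃ = 𝟙 + n`. Then `n` is annihilated by `T'.mor₂` before it and by `T'.mor₃` after
it. Since `T'` is not known to be distinguished, exactness is borrowed from `T`: it makes `n` factor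
through `T'.mor₃`. Hence `n ≫ n = 0`, and `𝟙 - n` is the inverse. -/
lemma isIso_hom₃_of_retract {T T' : Triangle C} (r : Retract T' T) (hT : T ∈ distTriang C)
    (φ : T' ⟶ T') (h₁ : φ.hom₁ = 𝟙 _) (h₂ : φ.hom₂ = 𝟙 _) : IsIso φ.hom₃ := by
  have hi₁ : r.i.hom₁ ≫ r.r.hom₁ = 𝟙 _ := congrArg TriangleMorphism.hom₁ r.retract
  have hi₃ : r.i.hom₃ ≫ r.r.hom₃ = 𝟙 _ := congrArg TriangleMorphism.hom₃ r.retract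
  obtain ⟨n, hn⟩ : ∃ n, φ.hom₃ = 𝟙 _ + n := ⟨φ.hom₃ - 𝟙 _, by abel⟩
  have hv : T'.mor₂ ≫ n = 0 := by
    have h := φ.comm₂
    rwa [hn, h₂, Preadditive.comp_add, Category.comp_id, Category.id_comp, add_eq_left] at h
  have hw : n ≫ T'.mor₃ = 0 := by
    have h := φ.comm₃
    rw [hn, h₁, Preadditive.add_comp, CategoryTheory.Functor.map_id, Category.comp_id,
      Category.id_comp] at h
    exact add_eq_left.1 h.symm
  obtain ⟨k, hk⟩ := Triangle.yoneda_exact₃ T hT (r.r.hom₃ ≫ n) (by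
    rw [reassoc_of% r.r.comm₂, hv, comp_zero])
  have hnk : n = T'.mor₃ ≫ r.i.hom₁⟦(1 : ℤ)⟧' ≫ k := by
    rw [reassoc_of% r.i.comm₃, ← hk, reassoc_of% hi₃]
  have hnn : n ≫ n = 0 := by
    nth_rw 2 [hnk]
    rw [reassoc_of% hw, zero_comp]
  exact ⟨𝟙 _ - n, by simp [hn, hnn], by simp [hn, hnn]⟩

/-- Complete `T'.mor₁` to a distinguished triangle `D` and compare it with `T'` in both directions
by passing through `T`. Both comparisons are identities on the first two objects, so both composites
are invertible on the third, and `T' ≅ D`. -/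
lemma distinguished_of_retract {T T' : Triangle C} (r : Retract T' T) (hT : T ∈ distTriang C) :
    T' ∈ distTriang C := by
  obtain ⟨Z, v, w, hD⟩ := distinguished_cocone_triangle T'.mor₁
  let D := Triangle.mk T'.mor₁ v w
  obtain ⟨c, hc₂, hc₃⟩ := complete_distinguished_triangle_morphism D T hD hT r.i.hom₁ r.i.hom₂
    r.i.comm₁
  obtain ⟨d, hd₂, hd₃⟩ := complete_distinguished_triangle_morphism T D hT hD r.r.hom₁ r.r.hom₂
    r.r.comm₁
  have hr₁ : r.i.hom₁ ≫ r.r.hom₁ = 𝟙 _ := congrArg TriangleMorphism.hom₁ r.retract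
  have hr₂ : r.i.hom₂ ≫ r.r.hom₂ = 𝟙 _ := congrArg TriangleMorphism.hom₂ r.retract
  let f : D ⟶ T' := (show D ⟶ T from ⟨r.i.hom₁, r.i.hom₂, c, r.i.comm₁, hc₂, hc₃⟩) ≫ r.r
  let g : T' ⟶ D := r.i ≫ (show T ⟶ D from ⟨r.r.hom₁, r.r.hom₂, d, r.r.comm₁, hd₂, hd₃⟩)
  have hf₁ : f.hom₁ = 𝟙 _ := hr₁
  have hf₂ : f.hom₂ = 𝟙 _ := hr₂
  have hg₁ : g.hom₁ = 𝟙 _ := hr₁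
  have hg₂ : g.hom₂ = 𝟙 _ := hr₂
  have h₁ : IsIso (g.hom₃ ≫ f.hom₃) := isIso_hom₃_of_retract r hT (g ≫ f)
    (by rw [comp_hom₁, hg₁, hf₁]; exact Category.comp_id _)
    (by rw [comp_hom₂, hg₂, hf₂]; exact Category.comp_id _)
  have h₂ : IsIso (f.hom₃ ≫ g.hom₃) := isIso_hom₃_of_retract (Retract.refl D) hD (f ≫ g)
    (by rw [comp_hom₁, hg₁, hf₁]; exact Category.comp_id _)
    (by rw [comp_hom₂, hg₂, hf₂]; exact Category.comp_id _)
  have : IsSplitMono g.hom₃ := ⟨⟨⟨f.hom₃ ≫ inv (g.hom₃ ≫ f.hom₃), by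
    rw [← Category.assoc, IsIso.hom_inv_id]⟩⟩⟩
  have : Epi g.hom₃ := ⟨fun a b h => by
    rw [← cancel_epi (f.hom₃ ≫ g.hom₃), Category.assoc, h, Category.assoc]⟩
  have : IsIso g.hom₃ := isIso_of_epi_of_isSplitMono _
  have : IsIso g := Triangle.isIso_of_isIsos g (by rw [hg₁]; exact IsIso.id _)
    (by rw [hg₂]; exact IsIso.id _) this
  exact isomorphic_distinguished _ hD _ (asIso g)

end RetractTriangle

/-! ## The idempotent on `x ⊗ y` with image `x ⊗_A y` -/

section Balanced

variable {K : Type u} [Category.{v} K] [Preadditive K] [HasZeroObject K] [HasShift K ℤ]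
  [∀ n : ℤ, (shiftFunctor K n).Additive] [Pretriangulated K] [MonoidalCategory K]
  [SymmetricCategory K] [TTCategory K] (A : K) [MonObj A]

lemma act_hom {x y : Mod K A} (f : x ⟶ y) : act A x ≫ f.hom = A ◁ f.hom ≫ act A y :=
  f.isModHom.smul_hom

variable [IsTTRing A]

/-- A bilinear section of the multiplication of a tt-ring. -/
noncomputable def mulSection : A ⟶ A ⊗ A := (IsTTRing.separable (A := A)).choose

lemma mulSection_spec : mulSection A ≫ μ[A] = 𝟙 A ∧
    mulSection A ▷ A ≫ (α_ A A A).hom ≫ A ◁ μ[A] = μ[A] ≫ mulSection A ∧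
    A ◁ mulSection A ≫ (α_ A A A).inv ≫ μ[A] ▷ A = μ[A] ≫ mulSection A :=
  (IsTTRing.separable (A := A)).choose_spec

/-- The `A`-linear section of the action on a module induced by `mulSection`. -/
noncomputable def actSection (y : Mod K A) : y.X ⟶ A ⊗ y.X :=
  (λ_ y.X).inv ≫ (η[A] ≫ mulSection A) ▷ y.X ≫ (α_ A A y.X).hom ≫ A ◁ act A y

lemma actSection_act (y : Mod K A) : actSection A y ≫ act A y = 𝟙 _ := by
  simp only [actSection, Category.assoc, act_assoc, Iso.hom_inv_id_assoc]
  rw [← comp_whiskerRight_assoc, Category.assoc, (mulSection_spec A).1, Category.comp_id, act_one]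
  simp

/-- With σ the chosen section of μ, `actSection` is y ↦ σ(1)y. Both sides are a ⊗ y ↦ σ(a)y: one by
right linearity of σ, the other by left linearity. -/
lemma act_actSection (y : Mod K A) :
    act A y ≫ actSection A y = A ◁ actSection A y ≫ (α_ A A y.X).inv ≫ μ[A] ▷ y.X :=
  (section_left_aux _ _ (act_assoc A y) (mulSection_spec A).2.1).trans
    (section_right_aux _ _ (mulSection_spec A).2.2).symm

/-- The section is built from one fixed `mulSection`, the unit and the action, so it commutes with
module maps. An arbitrary linear section for each module would not give this. -/
lemma actSection_natural {y z : Mod K A} (f : y ⟶ z) :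
    f.hom ≫ actSection A z = actSection A y ≫ A ◁ f.hom := by
  have h : A ◁ act A y ≫ A ◁ f.hom = A ◁ A ◁ f.hom ≫ A ◁ act A z := by
    rw [← MonoidalCategory.whiskerLeft_comp, act_hom, MonoidalCategory.whiskerLeft_comp]
  simp only [actSection, Category.assoc]
  rw [h, leftUnitor_inv_naturality_assoc, whisker_exchange_assoc]
  simp

lemma actSection_shift (y : Mod K A) (n : ℤ) :
    actSection A (y⟦n⟧) ≫ (tensorShiftIso A y.X n).hom = (actSection A y)⟦n⟧' := by
  change ((λ_ (y.X⟦n⟧)).inv ≫ (η[A] ≫ mulSection A) ▷ (y.X⟦n⟧) ≫ (α_ A A (y.X⟦n⟧)).hom ≫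
    A ◁ ((tensorShiftIso A y.X n).hom ≫ (act A y)⟦n⟧')) ≫ (tensorShiftIso A y.X n).hom = _
  simp only [Category.assoc, MonoidalCategory.whiskerLeft_comp]
  rw [tensorShiftIso_natural_right, ← reassoc_of% @tensorShiftIso_assoc,
    reassoc_of% @tensorShiftIso_natural_left, Iso.inv_comp_eq, ← tensorShiftIso_unit,
    Category.assoc]
  simp only [actSection, ← Functor.map_comp, Iso.hom_inv_id_assoc]

/-- The idempotent endomorphism of `x ⊗ y` whose image is `x ⊗_A y`. -/
noncomputable def balIdem (x y : Mod K A) : x.X ⊗ y.X ⟶ x.X ⊗ y.X :=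
  (x.X ◁ actSection A y ≫ (α_ x.X A y.X).inv) ≫ balLeft A x y

lemma balIdem_condition (x y : Mod K A) :
    balLeft A x y ≫ balIdem A x y = balRight A x y ≫ balIdem A x y :=
  balanced_aux (ract A x) μ[A] (act A y) _ (ract_assoc A x) (act_actSection A y)

/-- The first factor of `balIdem` is a section of `balRight`, and before a balanced `k` one may
replace `balLeft` by `balRight`. With `balIdem_condition`, this makes any splitting of `balIdem` a
coequalizer. -/
lemma balIdem_comp {x y : Mod K A} {z : K} (k : x.X ⊗ y.X ⟶ z)
    (hk : balLeft A x y ≫ k = balRight A x y ≫ k) : balIdem A x y ≫ k = k := by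
  have h : (x.X ◁ actSection A y ≫ (α_ x.X A y.X).inv) ≫ balRight A x y = 𝟙 _ := by
    simp only [Category.assoc, Iso.inv_hom_id_assoc, ← MonoidalCategory.whiskerLeft_comp,
      actSection_act, MonoidalCategory.whiskerLeft_id]
  rw [balIdem, Category.assoc, hk, ← Category.assoc, h, Category.id_comp]

lemma balIdem_linear (x y : Mod K A) :
    A ◁ balIdem A x y ≫ tensorAct A x y = tensorAct A x y ≫ balIdem A x y :=
  linear_aux (ract A x) (act A x) _ (ract_linear A x)

lemma balIdem_natural (x : Mod K A) {y z : Mod K A} (f : y ⟶ z) :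
    balIdem A x y ≫ x.X ◁ f.hom = x.X ◁ f.hom ≫ balIdem A x z := by
  have h : x.X ◁ f.hom ≫ x.X ◁ actSection A z = x.X ◁ actSection A y ≫ x.X ◁ A ◁ f.hom := by
    rw [← MonoidalCategory.whiskerLeft_comp, actSection_natural, MonoidalCategory.whiskerLeft_comp]
  simp only [balIdem, Category.assoc]
  rw [reassoc_of% h, ← whisker_exchange]
  simp

lemma bal_shift_aux {x y : K} {n : ℤ} (s' : y⟦n⟧ ⟶ A ⊗ y⟦n⟧) (s : y ⟶ A ⊗ y) (r : x ⊗ A ⟶ x)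
    (hs : s' ≫ (tensorShiftIso A y n).hom = s⟦n⟧') :
    ((x ◁ s' ≫ (α_ x A (y⟦n⟧)).inv) ≫ r ▷ (y⟦n⟧)) ≫ (tensorShiftIso x y n).hom =
      (tensorShiftIso x y n).hom ≫ ((x ◁ s ≫ (α_ x A y).inv) ≫ r ▷ y)⟦n⟧' := by
  have h : (α_ x A (y⟦n⟧)).inv ≫ (tensorShiftIso (x ⊗ A) y n).hom =
      x ◁ (tensorShiftIso A y n).hom ≫ (tensorShiftIso x (A ⊗ y) n).hom ≫
        (α_ x A y).inv⟦n⟧' := by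
    rw [Iso.inv_comp_eq, ← reassoc_of% @tensorShiftIso_assoc, ← Functor.map_comp, Iso.hom_inv_id,
      CategoryTheory.Functor.map_id, Category.comp_id]
  simp only [Category.assoc, Functor.map_comp]
  rw [tensorShiftIso_natural_left, reassoc_of% h, ← whiskerLeft_comp_assoc, hs,
    reassoc_of% @tensorShiftIso_natural_right]

lemma balIdem_shift (x y : Mod K A) (n : ℤ) :
    balIdem A x (y⟦n⟧) ≫ (tensorShiftIso x.X y.X n).hom =
      (tensorShiftIso x.X y.X n).hom ≫ (balIdem A x y)⟦n⟧' :=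
  bal_shift_aux A (actSection A (y⟦n⟧)) (actSection A y) (ract A x) (actSection_shift A y n)

lemma bal_tensor_aux {x y : K} (z : K) (s : y ⟶ A ⊗ y) (r : x ⊗ A ⟶ x) :
    (x ◁ (s ▷ z ≫ (α_ A y z).hom) ≫ (α_ x A (y ⊗ z)).inv) ≫ r ▷ (y ⊗ z) =
      (α_ x y z).inv ≫ ((x ◁ s ≫ (α_ x A y).inv) ≫ r ▷ y) ▷ z ≫ (α_ x y z).hom := by
  simp

lemma actSection_modTensor (y : Mod K A) (z : K) :
    actSection A (modTensor A y z) = actSection A y ▷ z ≫ (α_ A y.X z).hom := by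
  change (λ_ (y.X ⊗ z)).inv ≫ (η[A] ≫ mulSection A) ▷ (y.X ⊗ z) ≫ (α_ A A (y.X ⊗ z)).hom ≫
    A ◁ ((α_ A y.X z).inv ≫ act A y ▷ z) = _
  simp [actSection]

lemma balIdem_modTensor (x y : Mod K A) (z : K) :
    balIdem A x (modTensor A y z) =
      (α_ x.X y.X z).inv ≫ balIdem A x y ▷ z ≫ (α_ x.X y.X z).hom := by
  change (x.X ◁ actSection A (modTensor A y z) ≫ (α_ x.X A (y.X ⊗ z)).inv) ≫
    ract A x ▷ (y.X ⊗ z) = _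
  rw [actSection_modTensor]
  exact bal_tensor_aux A z (actSection A y) (ract A x)

end Balanced

end TTCategory

namespace TTCategory

/-! ## Models of the tensor product over a tt-ring -/

section RelativeTensor

variable {K : Type u} [Category.{v} K] [Preadditive K] [HasZeroObject K] [HasShift K ℤ]
  [∀ n : ℤ, (shiftFunctor K n).Additive] [Pretriangulated K] [MonoidalCategory K]
  [SymmetricCategory K] [TTCategory K] {A : K} [MonObj A] [IsTTRing A]

lemma shift_split_aux {x y z : K} {n : ℤ} {i : z ⟶ x ⊗ y} {p : x ⊗ y ⟶ z} (h : i ≫ p = 𝟙 z) :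
    (i⟦n⟧' ≫ (tensorShiftIso x y n).inv) ≫ (tensorShiftIso x y n).hom ≫ p⟦n⟧' = 𝟙 _ := by
  rw [Category.assoc, Iso.inv_hom_id_assoc, ← Functor.map_comp, h, CategoryTheory.Functor.map_id]

lemma shift_idem_aux {x y z : K} {n : ℤ} {i : z ⟶ x ⊗ y} {p : x ⊗ y ⟶ z} {e : x ⊗ y ⟶ x ⊗ y}
    {e' : x ⊗ y⟦n⟧ ⟶ x ⊗ y⟦n⟧} (h : p ≫ i = e)
    (he : e' ≫ (tensorShiftIso x y n).hom = (tensorShiftIso x y n).hom ≫ e⟦n⟧') :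
    ((tensorShiftIso x y n).hom ≫ p⟦n⟧') ≫ i⟦n⟧' ≫ (tensorShiftIso x y n).inv = e' := by
  rw [(Iso.eq_comp_inv _).2 he, ← h, Functor.map_comp]
  simp only [Category.assoc]

lemma shift_linear_aux {B x y z : K} {n : ℤ} {a : B ⊗ x ⟶ x} {b : B ⊗ z ⟶ z} {p : x ⊗ y ⟶ z}
    (hl : ((α_ B x y).inv ≫ a ▷ y) ≫ p = B ◁ p ≫ b) :
    ((α_ B x (y⟦n⟧)).inv ≫ a ▷ (y⟦n⟧)) ≫ (tensorShiftIso x y n).hom ≫ p⟦n⟧' =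
      B ◁ ((tensorShiftIso x y n).hom ≫ p⟦n⟧') ≫ (tensorShiftIso B z n).hom ≫ b⟦n⟧' := by
  have h : (α_ B x (y⟦n⟧)).inv ≫ (tensorShiftIso (B ⊗ x) y n).hom =
      B ◁ (tensorShiftIso x y n).hom ≫ (tensorShiftIso B (x ⊗ y) n).hom ≫
        (α_ B x y).inv⟦n⟧' := by
    rw [Iso.inv_comp_eq, ← reassoc_of% @tensorShiftIso_assoc, ← Functor.map_comp, Iso.hom_inv_id,
      CategoryTheory.Functor.map_id, Category.comp_id]
  rw [MonoidalCategory.whiskerLeft_comp, Category.assoc, Category.assoc,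
    reassoc_of% @tensorShiftIso_natural_right, ← Functor.map_comp, ← hl,
    reassoc_of% @tensorShiftIso_natural_left, reassoc_of% h]
  simp only [Functor.map_comp, Category.assoc]

lemma modTensor_split_aux {x y z w : K} {i : w ⟶ x ⊗ y} {p : x ⊗ y ⟶ w} (h : i ≫ p = 𝟙 w) :
    (i ▷ z ≫ (α_ x y z).hom) ≫ (α_ x y z).inv ≫ p ▷ z = 𝟙 _ := by
  rw [Category.assoc, Iso.hom_inv_id_assoc, ← comp_whiskerRight, h, id_whiskerRight]

lemma modTensor_idem_aux {x y z w : K} {i : w ⟶ x ⊗ y} {p : x ⊗ y ⟶ w} {e : x ⊗ y ⟶ x ⊗ y}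
    (h : p ≫ i = e) : ((α_ x y z).inv ≫ p ▷ z) ≫ i ▷ z ≫ (α_ x y z).hom =
      (α_ x y z).inv ≫ e ▷ z ≫ (α_ x y z).hom := by
  simp [← h]

lemma modTensor_linear_aux {B x y z w : K} {a : B ⊗ x ⟶ x} {b : B ⊗ w ⟶ w} {p : x ⊗ y ⟶ w}
    (hl : ((α_ B x y).inv ≫ a ▷ y) ≫ p = B ◁ p ≫ b) :
    ((α_ B x (y ⊗ z)).inv ≫ a ▷ (y ⊗ z)) ≫ (α_ x y z).inv ≫ p ▷ z =
      B ◁ ((α_ x y z).inv ≫ p ▷ z) ≫ (α_ B w z).inv ≫ b ▷ z := by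
  have h := congrArg (· ▷ z) hl
  simp only [comp_whiskerRight, Category.assoc] at h
  rw [MonoidalCategory.whiskerLeft_comp, Category.assoc (B ◁ (α_ x y z).inv),
    associator_inv_naturality_middle_assoc, ← h]
  simp

namespace RelTensor

/-- The section of `x ⊗ y ⟶ x ⊗_A y` corresponding to `balIdem`. -/
noncomputable def incl {x y : Mod K A} (R : RelTensor A x y) : R.obj.X ⟶ x.X ⊗ y.X :=
  (Cofork.IsColimit.desc' R.isColimit (balIdem A x y) (balIdem_condition A x y)).1

lemma π_incl {x y : Mod K A} (R : RelTensor A x y) : R.π ≫ R.incl = balIdem A x y :=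
  (Cofork.IsColimit.desc' R.isColimit (balIdem A x y) (balIdem_condition A x y)).2

lemma balIdem_π {x y : Mod K A} (R : RelTensor A x y) : balIdem A x y ≫ R.π = R.π :=
  balIdem_comp A _ R.condition

lemma π_cancel {x y : Mod K A} (R : RelTensor A x y) {z : K} {f g : R.obj.X ⟶ z}
    (h : R.π ≫ f = R.π ≫ g) : f = g :=
  Cofork.IsColimit.hom_ext R.isColimit h

lemma incl_π {x y : Mod K A} (R : RelTensor A x y) : R.incl ≫ R.π = 𝟙 _ :=
  R.π_cancel (by rw [reassoc_of% R.π_incl, R.balIdem_π, Category.comp_id])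

lemma incl_balIdem {x y : Mod K A} (R : RelTensor A x y) : R.incl ≫ balIdem A x y = R.incl := by
  rw [← R.π_incl, reassoc_of% R.incl_π]

lemma tensorAct_π {x y : Mod K A} (R : RelTensor A x y) {z : K} (g : R.obj.X ⟶ z) :
    tensorAct A x y ≫ R.π ≫ g = A ◁ R.π ≫ act A R.obj ≫ g := by
  rw [← Category.assoc, R.linear, Category.assoc]

lemma tensorAct_natural (x : Mod K A) {y z : Mod K A} (f : y.X ⟶ z.X) :
    tensorAct A x y ≫ x.X ◁ f = A ◁ x.X ◁ f ≫ tensorAct A x z := by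
  simp [tensorAct, ← whisker_exchange]

/-- Linearity can be tested after `A ◁ R.π`, which is a split epimorphism with section `A ◁ R.incl`.
-/
lemma linear_of_π {x y w : Mod K A} (R : RelTensor A x y) (g : R.obj.X ⟶ w.X)
    (h : tensorAct A x y ≫ R.π ≫ g = A ◁ (R.π ≫ g) ≫ act A w) :
    act A R.obj ≫ g = A ◁ g ≫ act A w := by
  have h' : A ◁ R.incl ≫ A ◁ R.π = 𝟙 _ := by
    rw [← MonoidalCategory.whiskerLeft_comp, incl_π, MonoidalCategory.whiskerLeft_id]
  rw [R.tensorAct_π, MonoidalCategory.whiskerLeft_comp, Category.assoc] at h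
  have h'' := congrArg (A ◁ R.incl ≫ ·) h
  beta_reduce at h''
  rwa [reassoc_of% h', reassoc_of% h'] at h''

/-- A splitting of `balIdem` by an `A`-linear projection is a tensor product over `A`. -/
noncomputable def ofSplitting {x y w : Mod K A} (π : x.X ⊗ y.X ⟶ w.X) (i : w.X ⟶ x.X ⊗ y.X)
    (h₁ : i ≫ π = 𝟙 _) (h₂ : π ≫ i = balIdem A x y)
    (hl : tensorAct A x y ≫ π = A ◁ π ≫ act A w) : RelTensor A x y where
  obj := w
  π := π
  condition := by
    have h : π = balIdem A x y ≫ π := by rw [← h₂, Category.assoc, h₁, Category.comp_id]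
    rw [h, ← Category.assoc, balIdem_condition, Category.assoc]
  isColimit := Cofork.IsColimit.mk _ (fun k => i ≫ k.π)
    (fun k => by
      change π ≫ i ≫ k.π = k.π
      rw [← Category.assoc, h₂, balIdem_comp A _ k.condition])
    (fun k l hl => by
      change π ≫ l = k.π at hl
      change l = i ≫ k.π
      exact (Category.id_comp l).symm.trans ((congrArg (· ≫ l) h₁.symm).trans
        ((Category.assoc _ _ _).trans (congrArg (i ≫ ·) hl))))
  linear := hl

lemma ofSplitting_incl {x y w : Mod K A} (π : x.X ⊗ y.X ⟶ w.X) (i : w.X ⟶ x.X ⊗ y.X)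
    (h₁ : i ≫ π = 𝟙 _) (h₂ : π ≫ i = balIdem A x y)
    (hl : tensorAct A x y ≫ π = A ◁ π ≫ act A w) : (ofSplitting π i h₁ h₂ hl).incl = i :=
  (ofSplitting π i h₁ h₂ hl).π_cancel ((π_incl _).trans h₂.symm)

/-- Functoriality of the tensor product over `A` in the second variable. -/
noncomputable def map {x y z : Mod K A} (R : RelTensor A x y) (S : RelTensor A x z) (f : y ⟶ z) :
    R.obj ⟶ S.obj :=
  Mod.Hom.mk' (R.incl ≫ x.X ◁ f.hom ≫ S.π) (R.linear_of_π _ (by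
    rw [reassoc_of% R.π_incl, reassoc_of% balIdem_natural, S.balIdem_π,
      MonoidalCategory.whiskerLeft_comp, Category.assoc (A ◁ x.X ◁ f.hom), ← S.linear, ← Category.assoc, tensorAct_natural,
      Category.assoc]))

lemma map_hom {x y z : Mod K A} (R : RelTensor A x y) (S : RelTensor A x z) (f : y ⟶ z) :
    (map R S f).hom = R.incl ≫ x.X ◁ f.hom ≫ S.π :=
  rfl

/-- Together with `π_map`, this exhibits x ⊗_A - as a retract of x ⊗ - naturally in the second
variable; both follow from `balIdem_natural`. -/
lemma map_incl {x y z : Mod K A} (R : RelTensor A x y) (S : RelTensor A x z) (f : y ⟶ z) :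
    (map R S f).hom ≫ S.incl = R.incl ≫ x.X ◁ f.hom := by
  rw [map_hom, Category.assoc, Category.assoc, S.π_incl, ← balIdem_natural,
    reassoc_of% R.incl_balIdem]

lemma π_map {x y z : Mod K A} (R : RelTensor A x y) (S : RelTensor A x z) (f : y ⟶ z) :
    R.π ≫ (map R S f).hom = x.X ◁ f.hom ≫ S.π := by
  rw [map_hom, reassoc_of% R.π_incl, reassoc_of% balIdem_natural, S.balIdem_π]

lemma map_id {x y : Mod K A} (R : RelTensor A x y) : map R R (𝟙 y) = 𝟙 _ := by
  ext
  simp [map_hom, incl_π]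

lemma map_comp {x y z w : Mod K A} (R : RelTensor A x y) (S : RelTensor A x z)
    (T : RelTensor A x w) (f : y ⟶ z) (g : z ⟶ w) :
    map R S f ≫ map S T g = map R T (f ≫ g) := by
  ext
  refine R.π_cancel ?_
  simp [π_map, reassoc_of% @π_map]

/-- The tensor product over `A` preserves retracts. -/
noncomputable def mapRetract {x y z : Mod K A} (R : RelTensor A x y) (S : RelTensor A x z)
    (r : Retract y z) : Retract R.obj S.obj where
  i := map R S r.i
  r := map S R r.r
  retract := by rw [map_comp, r.retract, map_id]

/-- A shift of `x ⊗_A y` is a tensor product of `x` and a shift of `y`. -/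
noncomputable def shift {x y : Mod K A} (R : RelTensor A x y) (n : ℤ) : RelTensor A x (y⟦n⟧) :=
  ofSplitting (w := R.obj⟦n⟧)
    ((tensorShiftIso x.X y.X n).hom ≫ R.π⟦n⟧') (R.incl⟦n⟧' ≫ (tensorShiftIso x.X y.X n).inv)
    (shift_split_aux R.incl_π) (shift_idem_aux R.π_incl (balIdem_shift A x y n))
    (shift_linear_aux R.linear)

lemma shift_π {x y : Mod K A} (R : RelTensor A x y) (n : ℤ) :
    (R.shift n).π = (tensorShiftIso x.X y.X n).hom ≫ R.π⟦n⟧' :=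
  rfl

lemma shift_incl {x y : Mod K A} (R : RelTensor A x y) (n : ℤ) :
    (R.shift n).incl = R.incl⟦n⟧' ≫ (tensorShiftIso x.X y.X n).inv :=
  ofSplitting_incl _ _ _ _ _

/-- `x ⊗_A (y ⊗ z)` is `(x ⊗_A y) ⊗ z`. -/
noncomputable def modTensor {x y : Mod K A} (R : RelTensor A x y) (z : K) :
    RelTensor A x (TTCategory.modTensor A y z) :=
  ofSplitting (w := TTCategory.modTensor A R.obj z)
    ((α_ x.X y.X z).inv ≫ R.π ▷ z) (R.incl ▷ z ≫ (α_ x.X y.X z).hom)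
    (modTensor_split_aux R.incl_π)
    ((modTensor_idem_aux R.π_incl).trans (balIdem_modTensor A x y z).symm)
    (modTensor_linear_aux R.linear)

/-- A balanced map does not distinguish `A` acting on `y` from `A` acting on `x`. The rest is the
hexagon, with symmetry cancelling the double braiding of `A` and `x`. -/
lemma braiding_act {x y : Mod K A} {w : K} {k : x.X ⊗ y.X ⟶ w}
    (hk : balLeft A x y ≫ k = balRight A x y ≫ k) :
    (β_ (A ⊗ y.X) x.X).hom ≫ x.X ◁ act A y ≫ k =
      (α_ A y.X x.X).hom ≫ A ◁ (β_ y.X x.X).hom ≫ tensorAct A x y ≫ k := by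
  have h : x.X ◁ act A y ≫ k =
      (α_ x.X A y.X).inv ≫ (β_ x.X A).hom ▷ y.X ≫ act A x ▷ y.X ≫ k := by
    rw [Iso.eq_inv_comp, ← comp_whiskerRight_assoc, hk, Category.assoc]
  rw [h, BraidedCategory.braiding_tensor_left_hom]
  simp only [Category.assoc, Iso.hom_inv_id_assoc]
  rw [← comp_whiskerRight_assoc, SymmetricCategory.symmetry]
  simp

lemma braiding_condition {x y : Mod K A} {w : K} {k : x.X ⊗ y.X ⟶ w}
    (hk : balLeft A x y ≫ k = balRight A x y ≫ k) :
    balLeft A y x ≫ (β_ y.X x.X).hom ≫ k = balRight A y x ≫ (β_ y.X x.X).hom ≫ k := by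
  rw [← Category.assoc, BraidedCategory.braiding_naturality_left,
    MonoidalCategory.whiskerLeft_comp, Category.assoc, Category.assoc,
    ← BraidedCategory.braiding_naturality_left_assoc, braiding_act hk,
    Category.assoc (α_ y.X A x.X).hom, BraidedCategory.braiding_naturality_right_assoc,
    BraidedCategory.braiding_tensor_right_hom]
  simp

/-- The tensor product over `A` is symmetric. -/
noncomputable def symm {x y : Mod K A} (R : RelTensor A x y) : RelTensor A y x where
  obj := R.obj
  π := (β_ y.X x.X).hom ≫ R.π
  condition := braiding_condition R.condition
  -- The universal property is checked directly, which avoids comparing `balIdem A y x` with the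
  -- conjugate of `balIdem A x y` under the braiding.
  isColimit := Cofork.IsColimit.mk _
    (fun k => R.incl ≫ (β_ x.X y.X).hom ≫ k.π)
    (fun k => by
      change ((β_ y.X x.X).hom ≫ R.π) ≫ R.incl ≫ (β_ x.X y.X).hom ≫ k.π = k.π
      rw [Category.assoc, reassoc_of% R.π_incl, balIdem_comp A _ (braiding_condition k.condition)]
      simp)
    (fun k l hl => by
      change ((β_ y.X x.X).hom ≫ R.π) ≫ l = k.π at hl
      rw [← hl]
      simp [reassoc_of% R.incl_π])
  linear := by
    change ((α_ A y.X x.X).inv ≫ act A y ▷ x.X) ≫ (β_ y.X x.X).hom ≫ R.π = _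
    rw [Category.assoc, BraidedCategory.braiding_naturality_left_assoc, braiding_act R.condition,
      Iso.inv_hom_id_assoc, R.linear, MonoidalCategory.whiskerLeft_comp, Category.assoc]

end RelTensor

lemma symm_nonempty (x y : Mod K A) :
    Nonempty ((relTensor A x y).obj ≅ (relTensor A y x).obj) :=
  RelTensor.nonempty_iso A (relTensor A x y) (relTensor A y x).symm

lemma modTensor_nonempty (x y : Mod K A) (z : K) :
    Nonempty ((relTensor A x (modTensor A y z)).obj ≅ modTensor A (relTensor A x y).obj z) :=
  RelTensor.nonempty_iso A (relTensor A x (modTensor A y z)) ((relTensor A x y).modTensor z)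

variable (A) in
/-- The tensor product of a module with a triangle of modules. -/
noncomputable def relTensorTriangle (x : Mod K A) (T : Triangle (Mod K A)) : Triangle (Mod K A) :=
  Triangle.mk ((relTensor A x T.obj₁).map (relTensor A x T.obj₂) T.mor₁)
    ((relTensor A x T.obj₂).map (relTensor A x T.obj₃) T.mor₂)
    -- The model `shift 1` has the shift of x ⊗_A `T.obj₁` itself as its object, so this map has the
    -- target that a triangle requires.
    ((relTensor A x T.obj₃).map ((relTensor A x T.obj₁).shift 1) T.mor₃)

/-- The maps `incl` and `π` make the underlying triangle a retract of x ⊗ T, which is distinguished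
in `K`. -/
lemma relTensorTriangle_dist (x : Mod K A) (T : Triangle (Mod K A))
    (hT : T ∈ TTData.dist (C := Mod K A)) :
    relTensorTriangle A x T ∈ TTData.dist (C := Mod K A) := by
  let U := (tensorLeft x.X).mapTriangle.obj (underlyingTriangle A T)
  have hU : U ∈ distTriang K := (tensorLeft x.X).map_distinguished _ hT
  refine distinguished_of_retract (T := U)
    { i := ⟨(relTensor A x T.obj₁).incl, (relTensor A x T.obj₂).incl, (relTensor A x T.obj₃).incl,
        RelTensor.map_incl _ _ _, RelTensor.map_incl _ _ _, ?_⟩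
      r := ⟨(relTensor A x T.obj₁).π, (relTensor A x T.obj₂).π, (relTensor A x T.obj₃).π,
        (RelTensor.π_map _ _ _).symm, (RelTensor.π_map _ _ _).symm, ?_⟩
      retract := Triangle.hom_ext _ _ (RelTensor.incl_π _) (RelTensor.incl_π _)
        (RelTensor.incl_π _) } hU
  · have h := RelTensor.map_incl (relTensor A x T.obj₃) ((relTensor A x T.obj₁).shift 1) T.mor₃
    rw [RelTensor.shift_incl] at h
    exact ((Iso.comp_inv_eq _).1 ((Category.assoc _ _ _).trans h)).trans (Category.assoc _ _ _)
  · have h := RelTensor.π_map (relTensor A x T.obj₃) ((relTensor A x T.obj₁).shift 1) T.mor₃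
    rw [RelTensor.shift_π] at h
    exact (Category.assoc _ _ _).trans h.symm

end RelativeTensor

end TTCategory

/-! ## Thick tensor-ideals -/

section Ideal

variable {C : Type u} [Category.{v} C] [HasShift C ℤ] [TTData C]

lemma IsThickTensorIdeal.of_iso {J : ObjectProperty C} (hJ : IsThickTensorIdeal J) {x y : C}
    (e : x ≅ y) (h : J y) : J x :=
  hJ.summand x y e.retract h

/-- The union of a nonempty chain of thick tensor-ideals is a thick tensor-ideal. -/
lemma IsThickTensorIdeal.exists_of_chain {c : Set (ObjectProperty C)} (hc : IsChain (· ≤ ·) c)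
    (h : ∀ J ∈ c, IsThickTensorIdeal J) (hne : c.Nonempty) :
    IsThickTensorIdeal (fun x => ∃ J ∈ c, J x : ObjectProperty C) := by
  have two {x y : C} : (∃ J ∈ c, J x) → (∃ J ∈ c, J y) → ∃ J ∈ c, J x ∧ J y := by
    rintro ⟨J, hJ, hx⟩ ⟨J', hJ', hy⟩
    rcases hc.total hJ hJ' with hle | hle
    · exact ⟨J', hJ', hle _ hx, hy⟩
    · exact ⟨J, hJ, hx, hle _ hy⟩
  obtain ⟨J₀, hJ₀⟩ := hne
  exact {
    zero := (h J₀ hJ₀).zero.imp fun z hz => ⟨hz.1, J₀, hJ₀, hz.2⟩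
    shift := fun x n ⟨J, hJ, hx⟩ => ⟨J, hJ, (h J hJ).shift x n hx⟩
    ext₁ := fun T hT h₂ h₃ =>
      let ⟨J, hJ, h₂, h₃⟩ := two h₂ h₃; ⟨J, hJ, (h J hJ).ext₁ T hT h₂ h₃⟩
    ext₂ := fun T hT h₁ h₃ =>
      let ⟨J, hJ, h₁, h₃⟩ := two h₁ h₃; ⟨J, hJ, (h J hJ).ext₂ T hT h₁ h₃⟩
    ext₃ := fun T hT h₁ h₂ =>
      let ⟨J, hJ, h₁, h₂⟩ := two h₁ h₂; ⟨J, hJ, (h J hJ).ext₃ T hT h₁ h₂⟩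
    summand := fun x y r ⟨J, hJ, hy⟩ => ⟨J, hJ, (h J hJ).summand x y r hy⟩
    tensor := fun x y ⟨J, hJ, hy⟩ => ⟨J, hJ, (h J hJ).tensor x y hy⟩ }

/-- A prime specializes exactly to the primes contained in it. -/
lemma Spc.mem_closure_singleton {P P' : Spc C} : P' ∈ closure {P} ↔ P' ≤ P := by
  rw [← specializes_iff_mem_closure, specializes_iff_forall_open]
  constructor
  · intro h x hx
    -- Basic opens consist of the primes containing `x`, so specialization makes primes smaller,
    -- unlike in the Zariski topology.
    exact h {P | P.carrier x} (TopologicalSpace.isOpen_generateFrom_of_mem ⟨x, rfl⟩) hx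
  · intro h s hs
    induction hs with
    | basic s hs =>
      obtain ⟨x, rfl⟩ := hs
      exact h x
    | univ => exact fun _ => trivial
    | inter s t _ _ hs ht => exact fun hP => ⟨hs hP.1, ht hP.2⟩
    | sUnion S _ hS => exact fun ⟨s, hs, hP⟩ => ⟨s, hs, hS s hs hP⟩

end Ideal

/-! ### Ideals of modules, and primality of maximal avoiding ideals -/

namespace TTCategory

section ModuleIdeal

variable {K : Type u} [Category.{v} K] [Preadditive K] [HasZeroObject K] [HasShift K ℤ]
  [∀ n : ℤ, (shiftFunctor K n).Additive] [Pretriangulated K] [MonoidalCategory K]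
  [SymmetricCategory K] [TTCategory K]

lemma _root_.Spc.not_carrier_unit (P : Spc K) : ¬ P.carrier (𝟙_ K) := fun h =>
  let ⟨x, hx⟩ := P.proper
  hx (P.isThickTensorIdeal.of_iso (ρ_ x).symm (P.isThickTensorIdeal.tensor x _ h))

variable {A : K} [MonObj A]

lemma modTensor_assoc_nonempty (x : Mod K A) (y z : K) :
    Nonempty (modTensor A (modTensor A x y) z ≅ modTensor A x (y ⊗ z)) :=
  ⟨modIso (α_ x.X y z) (by
    change ((α_ A (x.X ⊗ y) z).inv ≫ ((α_ A x.X y).inv ≫ act A x ▷ y) ▷ z) ≫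
      (α_ x.X y z).hom = A ◁ (α_ x.X y z).hom ≫ (α_ A x.X (y ⊗ z)).inv ≫ act A x ▷ (y ⊗ z)
    simp)⟩

lemma modTensor_congr {x y : Mod K A} (e : x ≅ y) (z : K) :
    Nonempty (modTensor A x z ≅ modTensor A y z) :=
  ⟨modIso (whiskerRightIso ((Mod.forget A).mapIso e) z) (by
    change ((α_ A x.X z).inv ≫ act A x ▷ z) ≫ e.hom.hom ▷ z =
      A ◁ e.hom.hom ▷ z ≫ (α_ A y.X z).inv ≫ act A y ▷ z
    rw [Category.assoc, ← comp_whiskerRight, act_hom, comp_whiskerRight,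
      associator_inv_naturality_middle_assoc])⟩

lemma isZero_of_X {x : Mod K A} (h : IsZero x.X) : IsZero x where
  unique_to w := ⟨⟨⟨Mod.Hom.mk' (h.to_ w.X) (((tensorLeft A).map_isZero h).eq_of_src _ _)⟩,
    fun _ => by ext; exact h.eq_of_src _ _⟩⟩
  unique_from w := ⟨⟨⟨Mod.Hom.mk' (h.from_ w.X) (h.eq_of_tgt _ _)⟩,
    fun _ => by ext; exact h.eq_of_tgt _ _⟩⟩

variable [IsTTRing A]

/-- `x ⊗_A y` is a direct summand of `x ⊗ y`. -/
noncomputable def relTensorRetract (x y : Mod K A) :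
    Retract (relTensor A x y).obj (modTensor A x y.X) where
  i := Mod.Hom.mk' (relTensor A x y).incl ((relTensor A x y).linear_of_π
    (w := modTensor A x y.X) _ ((congrArg (tensorAct A x y ≫ ·) (relTensor A x y).π_incl).trans
      ((balIdem_linear A x y).symm.trans
        (congrArg (A ◁ · ≫ tensorAct A x y) (relTensor A x y).π_incl.symm))))
  r := Mod.Hom.mk' (M := modTensor A x y.X) (relTensor A x y).π (relTensor A x y).linear
  retract := by
    ext
    exact (relTensor A x y).incl_π

/-- Every module over a tt-ring is a direct summand of the free module on its underlying object. -/
noncomputable def extendScalarsRetract (x : Mod K A) :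
    Retract x ((extendScalars A).obj x.X) where
  i := Mod.Hom.mk' (N := (extendScalars A).obj x.X) (actSection A x) (act_actSection A x)
  r := Mod.Hom.mk' (M := (extendScalars A).obj x.X) (act A x) (by
    change ((α_ A A x.X).inv ≫ μ[A] ▷ x.X) ≫ act A x = A ◁ act A x ≫ act A x
    rw [act_assoc, Category.assoc])
  retract := by
    ext
    exact actSection_act A x

lemma mem_relTensor_symm {I : ObjectProperty (Mod K A)} (hI : IsThickTensorIdeal I)
    {x y : Mod K A} (h : I (relTensor A x y).obj) :
    I (relTensor A y x).obj :=
  hI.of_iso (symm_nonempty y x).some h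

/-- By the projection formula, tensoring with an object of `K` is tensoring over `A` with a free
module. -/
lemma mem_modTensor {I : ObjectProperty (Mod K A)} (hI : IsThickTensorIdeal I)
    {x : Mod K A} (h : I x) (z : K) : I (modTensor A x z) :=
  hI.of_iso (projection_formula A x z).some.symm (mem_relTensor_symm hI (hI.tensor _ _ h))

/-- The ideal quotient of a thick tensor-ideal by a module. -/
lemma isThickTensorIdeal_quotient {I : ObjectProperty (Mod K A)} (hI : IsThickTensorIdeal I)
    (b : Mod K A) :
    IsThickTensorIdeal (fun x => I (relTensor A b x).obj : ObjectProperty (Mod K A)) where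
  zero := hI.zero.imp fun z hz => ⟨hz.1, hI.tensor b z hz.2⟩
  shift x n h := hI.of_iso (RelTensor.nonempty_iso A _ ((relTensor A b x).shift n)).some
    (hI.shift _ n h)
  ext₁ T hT := hI.ext₁ _ (relTensorTriangle_dist b T hT)
  ext₂ T hT := hI.ext₂ _ (relTensorTriangle_dist b T hT)
  ext₃ T hT := hI.ext₃ _ (relTensorTriangle_dist b T hT)
  summand _ _ r h := hI.summand _ _ (RelTensor.mapRetract (relTensor A b _) (relTensor A b _) r) h
  tensor w x h := by
    -- Associativity of ⊗_A is not needed: w ⊗_A x is a summand of x ⊗ U(w), and b ⊗_A (x ⊗ U(w)) ≅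
    -- (b ⊗_A x) ⊗ U(w) lies in `I`.
    have r : Retract (relTensor A w x).obj (modTensor A x w.X) :=
      (symm_nonempty w x).some.retract.trans (relTensorRetract x w)
    exact hI.summand _ _ (RelTensor.mapRetract (relTensor A b _) (relTensor A b _) r)
      (hI.of_iso (modTensor_nonempty b x w.X).some (mem_modTensor hI h _))

/-- The modules whose underlying object lies in a thick tensor-ideal. -/
lemma isThickTensorIdeal_forget {J : ObjectProperty K} (hJ : IsThickTensorIdeal J) :
    IsThickTensorIdeal (fun x => J x.X : ObjectProperty (Mod K A)) where
  zero := by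
    obtain ⟨z, hz, hJz⟩ := hJ.zero
    exact ⟨(extendScalars A).obj z, isZero_of_X ((tensorLeft A).map_isZero hz),
      hJ.tensor A z hJz⟩
  shift x n h := hJ.shift x.X n h
  ext₁ T hT := hJ.ext₁ (underlyingTriangle A T) hT
  ext₂ T hT := hJ.ext₂ (underlyingTriangle A T) hT
  ext₃ T hT := hJ.ext₃ (underlyingTriangle A T) hT
  summand x y r h := hJ.summand x.X y.X (r.map (Mod.forget A)) h
  tensor x y h := hJ.summand _ (x.X ⊗ y.X)
    ((relTensorRetract x y).map (Mod.forget A)) (hJ.tensor _ _ h)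

/-- A thick tensor-ideal of modules that is maximal among those that send no product of a module
outside `Q` and an object outside `P` into it is prime. -/
lemma prime_of_maximal {Q : Spc (Mod K A)} {P : Spc K} {I : ObjectProperty (Mod K A)}
    (hI : Maximal (· ∈ {I : ObjectProperty (Mod K A) | IsThickTensorIdeal I ∧
      ∀ x s, I (modTensor A x s) → Q.carrier x ∨ P.carrier s}) I)
    {a b : Mod K A} (hab : I (relTensor A a b).obj) : I a ∨ I b := by
  -- The quotient of `I` by `c` contains `I` and also `d ∉ I`, so by maximality it must contain some
  -- avoided x ⊗ s.
  have key : ∀ {c d : Mod K A}, I (relTensor A c d).obj → ¬ I d →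
      ∃ x s, ¬ Q.carrier x ∧ ¬ P.carrier s ∧ I (relTensor A c (modTensor A x s)).obj := by
    intro c d hcd hd
    by_contra! h
    refine hd (hI.2 (y := fun x => I (relTensor A c x).obj)
      ⟨isThickTensorIdeal_quotient hI.1.1 c, fun x s hxs => ?_⟩
      (fun x hx => hI.1.1.tensor c x hx) d hcd)
    by_contra! hn
    exact h x s hn.1 hn.2 hxs
  by_contra! hn
  -- First `b` is replaced by an avoided module, then, after a swap, `a` is replaced too; the
  -- product of the two avoided modules lies in `I`.
  obtain ⟨x, s, hx, hs, hxs⟩ := key hab hn.2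
  obtain ⟨y, t, hy, ht, hyt⟩ := key (mem_relTensor_symm hI.1.1 hxs) hn.1
  -- This product is (y ⊗_A x) ⊗ (s ⊗ t), again an avoided module because `Q` and `P` are prime.
  have e₁ := (modTensor_nonempty (modTensor A x s) y t).some
  have e₂ := (modTensor_congr
    ((symm_nonempty (modTensor A x s) y).some ≪≫ (modTensor_nonempty y x s).some) t).some
  have e₃ := (modTensor_assoc_nonempty (relTensor A y x).obj s t).some
  rcases hI.1.2 _ _ (hI.1.1.of_iso (e₁ ≪≫ e₂ ≪≫ e₃).symm hyt) with h | h
  · exact (Q.prime y x h).elim hy hx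
  · exact (P.prime s t h).elim hs ht

/-- Going-up for inclusions of primes. -/
lemma exists_le_extendScalars_eq (Q : Spc (Mod K A)) (P : Spc K) (h : P ≤ Spc.extendScalars A Q) :
    ∃ Q' : Spc (Mod K A), Q' ≤ Q ∧ Spc.extendScalars A Q' = P := by
  obtain ⟨I, hPI, hI⟩ := zorn_le_nonempty₀ {I : ObjectProperty (Mod K A) | IsThickTensorIdeal I ∧
      ∀ x s, I (modTensor A x s) → Q.carrier x ∨ P.carrier s}
    (fun c hcs hc J hJ => ⟨_, ⟨.exists_of_chain hc (fun J hJ => (hcs hJ).1) ⟨J, hJ⟩,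
      fun x s ⟨J, hJ, hx⟩ => (hcs hJ).2 x s hx⟩, fun J hJ x hx => ⟨J, hJ, hx⟩⟩)
    (fun x => P.carrier x.X)
    -- The hypothesis `h` is used only here: U(x) ∈ P gives F(U(x)) ∈ Q, and x is a summand of
    -- F(U(x)).
    ⟨isThickTensorIdeal_forget P.isThickTensorIdeal, fun x s hxs => (P.prime x.X s hxs).imp_left
      fun hx => Q.isThickTensorIdeal.summand _ _ (extendScalarsRetract x) (h _ hx)⟩
  have hIQ : I ≤ Q.carrier := fun x hx =>
    (hI.1.2 x (𝟙_ K) (mem_modTensor hI.1.1 hx _)).resolve_right P.not_carrier_unit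
  have hF : ¬ Q.carrier ((extendScalars A).obj (𝟙_ K)) := (Spc.extendScalars A Q).not_carrier_unit
  refine ⟨⟨I, hI.1.1, Q.proper.imp fun x hx hIx => hx (hIQ x hIx),
    fun a b => prime_of_maximal hI⟩, hIQ, Spc.ext (funext fun y => propext ⟨fun hy => ?_,
    fun hy => hPI _ (P.isThickTensorIdeal.tensor A y hy)⟩)⟩
  -- The avoidance condition is applied to F(𝟙) ⊗ y ≅ F(y).
  refine (hI.1.2 ((extendScalars A).obj (𝟙_ K)) y (hI.1.1.of_iso ?_ hy)).resolve_left hF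
  exact (projection_formula A _ y).some.symm ≪≫ (nonempty_extendScalars_tensor A (𝟙_ K) y).some ≪≫
    (extendScalars A).mapIso (λ_ y)

end ModuleIdeal

end TTCategory

theorem theorem3p4 {K : Type u} [Category.{v} K] [Preadditive K] [HasZeroObject K]
    [HasShift K ℤ] [∀ n : ℤ, (shiftFunctor K n).Additive] [Pretriangulated K]
    [MonoidalCategory K] [SymmetricCategory K] [TTCategory K]
    (A : K) [MonObj A] [IsTTRing A] (Q : Spc (Mod K A)) (P' : Spc K) :
    (P' ∈ closure {Spc.extendScalars A Q} →
      ∃ Q' ∈ closure {Q}, Spc.extendScalars A Q' = P') ∧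
    (P' ≤ Spc.extendScalars A Q →
      ∃ Q' : Spc (Mod K A), Q' ≤ Q ∧ Spc.extendScalars A Q' = P') := by
  refine ⟨fun h => ?_, TTCategory.exists_le_extendScalars_eq Q P'⟩
  obtain ⟨Q', hQ, hP⟩ :=
    TTCategory.exists_le_extendScalars_eq Q P' (Spc.mem_closure_singleton.1 h)
  exact ⟨Q', Spc.mem_closure_singleton.2 hQ, hP⟩
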